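/- Let $X\subset\mathbb{R}^n$ and $U\subset\mathbb{R}^m$ be open, let $E=X\times U\to X$ be the trivial bundle with points $z=(x,u)$, and let $\mathcal{D}(E)$ be the pseudo-group of all smooth ($C^\infty$) diffeomorphisms $\varphi$ between open subsets of $E$. Let $\mathcal{H}\subset\mathcal{D}(E)$ be a Lie pseudo-group: $\mathcal{H}$ is closed under composition, inversion, restriction to open sets and gluing, contains the identity maps of open subsets of $E$, and, with $\mathcal{H}_t=\{\,j^t\varphi|_z : \varphi\in\mathcal{H},\ z\in\operatorname{dom}\varphi\,\}$, * for every $t\ge 0$, near each of its points $\mathcal{H}_t$ is cut out, among the $t$-jets of elements of $\mathcal{D}(E)$ whose projections to order $p$ lie in $\mathcal{H}_p$ for all $p<t$, by a finite real-analytic system of determining equations $F^{(t)}(z,Z^{(t)})=0$ that has full rank in the jet coordinates of order exactly $t$ (at the points of $\mathcal{H}_t$); * there is an order $t^*$ such that every $\varphi\in\mathcal{D}(E)$ all of whose $t^*$-jets lie in $\mathcal{H}_{t^*}$ belongs to $\mathcal{H}$, and such that for every $p\ge t^*$ the set $\mathcal{H}_{p+1}$ contains the first prolongation of $\mathcal{H}_p$,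 i.e. the jets $j^{p+1}\varphi|_z$, $\varphi\in\mathcal{D}(E)$, for which $j^p\varphi|_z\in\mathcal{H}_p$ and the section $w\mapsto j^p\varphi|_w$ is tangent to $\mathcal{H}_p$ at $w=z$. Let $J^q(E)$ be the space of $q$-jets of smooth local sections $x\mapsto (x,u(x))$ of $E$, with projections $\pi^{q+1}_q:J^{q+1}(E)\to J^q(E)$. The prolonged action is $j^q\varphi|_{z}\cdot j^qu|_x=j^q\hat u|_{\hat x}$, defined when $z=(x,u(x))$ and $\varphi$ maps the graph of $u$ near $z$ into the graph of a smooth function $\hat u$ near $\varphi(z)$, where $\hat x$ is the $X$-component of $\varphi(z)$. The action of $\mathcal{H}_q$ is free on a subset $V\subset J^q(E)$ if $g\in\mathcal{H}_q$, $s\in V$ and $g\cdot s=s$ imply that $g$ is the $q$-jet of the identity map at its source point. **Persistence of freeness.** Let $q\ge 1$ and let $V_q\subset J^q(E)$ be any subset. If the prolonged action of $\mathcal{H}_q$ is free on $V_q$, then the prolonged action of $\mathcal{H}_{q+1}$ is free on $(\pi^{q+1}_q)^{-1}(V_q)\subset J^{q+1}(E)$. -/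

import Mathlib

open Set Filter Topology
open scoped ContDiff

noncomputable section

namespace LiePseudoGroup

/-- The coordinate space `ℝⁿ × ℝᵐ` with points `z = (x, u)`. -/
abbrev Coord (n m : ℕ) : Type := (Fin n → ℝ) × (Fin m → ℝ)

/-- The ambient space of `q`-jets `(z, Z, …, Z^a_A, …)`, `|A| ≤ q`, of maps `z ↦ Z` of `ℝⁿ × ℝᵐ`:
the source point and, for each `k ≤ q`, the array of the derivatives of order `k`, written as a
`k`-linear map. Jets of maps are the elements with symmetric arrays. -/
abbrev MapJet (n m q : ℕ) : Type :=
  Coord n m × ((k : Fin (q + 1)) → (Coord n m [×(k : ℕ)]→L[ℝ] Coord n m))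

/-- The ambient space of `q`-jets `(x, u, …, u^α_J, …)`, `|J| ≤ q`, of maps `x ↦ u(x)`. -/
abbrev SecJet (n m q : ℕ) : Type :=
  (Fin n → ℝ) × ((k : Fin (q + 1)) → ((Fin n → ℝ) [×(k : ℕ)]→L[ℝ] (Fin m → ℝ)))

variable {n m : ℕ}

/-- The jet `j^q φ|_z`. -/
def mapJet (q : ℕ) (φ : Coord n m → Coord n m) (z : Coord n m) : MapJet n m q :=
  (z, fun k => iteratedFDeriv ℝ (k : ℕ) φ z)

/-- The jet `j^q u|_x` of the section `x ↦ (x, u(x))`. -/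
def secJet (q : ℕ) (u : (Fin n → ℝ) → (Fin m → ℝ)) (x : Fin n → ℝ) : SecJet n m q :=
  (x, fun k => iteratedFDeriv ℝ (k : ℕ) u x)

/-- Forgetting the derivatives of order above `p`. -/
def MapJet.proj {p q : ℕ} (h : p ≤ q) (j : MapJet n m q) : MapJet n m p :=
  (j.1, fun k => j.2 (Fin.castLE (Nat.succ_le_succ h) k))

/-- The canonical projection `π^q_p` of jets of sections. -/
def SecJet.proj {p q : ℕ} (h : p ≤ q) (s : SecJet n m q) : SecJet n m p :=
  (s.1, fun k => s.2 (Fin.castLE (Nat.succ_le_succ h) k))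

/-- The diffeomorphism pseudo-group `𝓓(E)`: smooth diffeomorphisms between open subsets of `E`. -/
def diffeoPseudoGroup (E : Set (Coord n m)) :
    Set (OpenPartialHomeomorph (Coord n m) (Coord n m)) :=
  {φ | φ.source ⊆ E ∧ φ.target ⊆ E ∧
    ContDiffOn ℝ ∞ φ φ.source ∧ ContDiffOn ℝ ∞ φ.symm φ.target}

/-- The set of `q`-jets of the elements of a collection of local transformations. -/
def jets (H : Set (OpenPartialHomeomorph (Coord n m) (Coord n m))) (q : ℕ) :
    Set (MapJet n m q) :=
  {j | ∃ φ ∈ H, ∃ z ∈ φ.source, j = mapJet q φ z}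

/-- The jet bundle `J^q(E)`: the `q`-jets of smooth local sections of `E`. -/
def sectionJets (E : Set (Coord n m)) (q : ℕ) : Set (SecJet n m q) :=
  {s | ∃ (u : (Fin n → ℝ) → (Fin m → ℝ)) (x : Fin n → ℝ),
    (∀ᶠ y in 𝓝 x, ContDiffAt ℝ ∞ u y) ∧ (x, u x) ∈ E ∧ s = secJet q u x}

/-- `H` is a pseudo-group of local diffeomorphisms of `E`. -/
structure IsPseudoGroup (E : Set (Coord n m))
    (H : Set (OpenPartialHomeomorph (Coord n m) (Coord n m))) : Prop where
  subset : H ⊆ diffeoPseudoGroup E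
  id_mem : ∀ (s : Set (Coord n m)) (hs : IsOpen s), s ⊆ E → OpenPartialHomeomorph.ofSet s hs ∈ H
  trans_mem : ∀ φ ∈ H, ∀ ψ ∈ H, φ.trans ψ ∈ H
  symm_mem : ∀ φ ∈ H, φ.symm ∈ H
  restr_mem : ∀ φ ∈ H, ∀ s : Set (Coord n m), IsOpen s → φ.restr s ∈ H
  locality : ∀ φ : OpenPartialHomeomorph (Coord n m) (Coord n m),
    (∀ z ∈ φ.source, ∃ s, IsOpen s ∧ z ∈ s ∧ φ.restr s ∈ H) → φ ∈ H
  congr_mem : ∀ φ ∈ H, ∀ ψ : OpenPartialHomeomorph (Coord n m) (Coord n m), ψ ≈ φ → ψ ∈ H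

/-- `F = 0` is a system of determining equations of order `t` for `H` on the open set `W` of
`t`-jets: it is real analytic, has full rank in the jet coordinates of order exactly `t`, and
together with the equations of lower order it cuts out the `t`-jets of elements of `H`.
Directions in the jet coordinates of order `t` are symmetric `t`-linear maps. -/
structure IsDeterminingSystem (E : Set (Coord n m))
    (H : Set (OpenPartialHomeomorph (Coord n m) (Coord n m))) (t : ℕ)
    (W : Set (MapJet n m t)) {k : ℕ} (F : MapJet n m t → (Fin k → ℝ)) : Prop where
  isOpen : IsOpen W
  analytic : AnalyticOnNhd ℝ F W
  full_rank : ∀ j ∈ W, j ∈ jets H t → ∀ c : Fin k → ℝ,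
    ∃ S : Coord n m [×t]→L[ℝ] Coord n m,
      (∀ (σ : Equiv.Perm (Fin t)) (v : Fin t → Coord n m), S (fun i => v (σ i)) = S v) ∧
      fderiv ℝ F j (0, Pi.single (Fin.last t) S) = c
  zero_set : ∀ j ∈ W, j ∈ jets (diffeoPseudoGroup E) t →
    (j ∈ jets H t ↔ (∀ (p : ℕ) (hp : p < t), MapJet.proj hp.le j ∈ jets H p) ∧ F j = 0)

/-- `H` is a Lie pseudo-group of local diffeomorphisms of `E`. The subgroupoid of `q`-jets is
`H_q = jets H q`. -/
structure IsLiePseudoGroup (E : Set (Coord n m))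
    (H : Set (OpenPartialHomeomorph (Coord n m) (Coord n m))) : Prop where
  isPseudoGroup : IsPseudoGroup E H
  /-- The jets of `H` of each order are given, in local coordinates, by determining equations. -/
  determining : ∀ (t : ℕ), ∀ j ∈ jets H t, ∃ (W : Set (MapJet n m t)) (k : ℕ)
    (F : MapJet n m t → (Fin k → ℝ)), j ∈ W ∧ IsDeterminingSystem E H t W F
  /-- `H` has finite order `t`: every local solution of the determining equations of order `≤ t`
  belongs to `H`, and the determining equations of higher order are differential consequences of
  them, that is, for `p ≥ t`, `H_{p+1}` contains the prolongation of `H_p` (the jets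
  `j^{p+1}φ|_z` for which the section `j^p φ` is tangent to `H_p` at `z`). -/
  finite_order : ∃ t : ℕ,
    (∀ φ ∈ diffeoPseudoGroup E, (∀ z ∈ φ.source, mapJet t φ z ∈ jets H t) → φ ∈ H) ∧
    ∀ p ≥ t, ∀ φ ∈ diffeoPseudoGroup E, ∀ z ∈ φ.source, mapJet p φ z ∈ jets H p →
      (∀ v, fderiv ℝ (mapJet p φ) z v ∈ tangentConeAt ℝ (jets H p) (mapJet p φ z)) →
      mapJet (p + 1) φ z ∈ jets H (p + 1)

/-- The prolonged action of jets of local diffeomorphisms on jets of sections: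
`j^q φ|_z · j^q u|_x = j^q û|_X`, where `z = (x, u(x))`, the diffeomorphism `φ` sends the graph of
`u` near `z` into the graph of `û`, and `X` is the horizontal part of `φ(z)`. -/
def ProlongedAction (E : Set (Coord n m)) (q : ℕ) (g : MapJet n m q) (s s' : SecJet n m q) :
    Prop :=
  ∃ φ ∈ diffeoPseudoGroup E, ∃ (u u' : (Fin n → ℝ) → (Fin m → ℝ)) (x : Fin n → ℝ),
    (x, u x) ∈ φ.source ∧ (∀ᶠ y in 𝓝 x, ContDiffAt ℝ ∞ u y) ∧
    (∀ᶠ y in 𝓝 (φ (x, u x)).1, ContDiffAt ℝ ∞ u' y) ∧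
    (∀ᶠ y in 𝓝 x, (φ (y, u y)).2 = u' (φ (y, u y)).1) ∧
    g = mapJet q φ (x, u x) ∧ s = secJet q u x ∧ s' = secJet q u' (φ (x, u x)).1

/-- The prolonged action of `H_q` is free on `V`: only identity jets fix an element of `V`. -/
def ActsFreelyOn (E : Set (Coord n m))
    (H : Set (OpenPartialHomeomorph (Coord n m) (Coord n m))) (q : ℕ) (V : Set (SecJet n m q)) :
    Prop :=
  ∀ s ∈ V, ∀ g ∈ jets H q, ProlongedAction E q g s s → g = mapJet q id g.1

end LiePseudoGroup

end

/-! Suppose `g ∈ H_{q+1}` fixes the jet of `u` at `x`. Its truncation fixes the `q`-jet, so freeness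
at order `q` makes it an identity jet, and `g` is determined by its symmetric array `N` of
derivatives of order `q + 1`. Put `A = fderiv ℝ u x`. Fixing the jet of `u` forces `N` to send
tuples of vectors tangent to the graph of `A` to tangent vectors (`iteratedFDeriv_graphError`).

Each contraction `N(v, ·)` solves the linearized order `q` determining equations at the identity
(`fderiv_apply_single_fderiv_iteratedFDeriv`). The key is infinitesimal freeness,
`eq_zero_of_mem_ker_of_isTangential`: a tangential symmetric solution is zero. Full rank and the
implicit function theorem give a curve of order `q` parts in the fiber of `H_q` over the identity
jet of order `q - 1`. This fiber is locally closed and stable under composition, which is addition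
for `q ≥ 2` and multiplication of linear parts for `q = 1`. It therefore contains the line, or the
one-parameter group, tangent to the curve. Its elements are tangential, so they fix the `q`-jet of
`u` (`prolongedAction_self_of_isTangential`), and freeness makes them trivial.

Two applications finish the proof. For `v` tangent to the graph, `N(v, ·)` is tangential, hence
zero. For arbitrary `v`, symmetry moves a tangent argument into the first slot, so `N(v, ·)`
vanishes on tangent tuples; it is tangential again, hence zero. -/

/-! ### The two extreme partitions in Faà di Bruno's formula -/

namespace OrderedFinpartition

/-- The ordered finpartition of `Fin n`, `0 < n`, into one part. -/
@[simps -fullyApplied]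
def indiscrete (n : ℕ) (hn : 0 < n) : OrderedFinpartition n where
  length := 1
  partSize _ := n
  partSize_pos _ := hn
  emb _ i := i
  emb_strictMono _ := strictMono_id
  parts_strictMono := Subsingleton.strictMono _
  disjoint _ _ _ _ h := absurd (Subsingleton.elim _ _) h
  cover i := ⟨0, i, rfl⟩

variable {n : ℕ}

lemma sum_partSize (c : OrderedFinpartition n) : ∑ i, c.partSize i = n := by
  simpa using c.sum_sigma_eq_sum (fun _ => (1 : ℕ))

lemma strictMono_fin_eq_self {f : Fin n → Fin n} (hf : StrictMono f) : f = fun i => i := by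
  have hs : Function.Surjective f := Finite.surjective_of_injective hf.injective
  have := Subsingleton.elim (hf.orderIsoOfSurjective f hs) (OrderIso.refl _)
  funext i
  exact congrArg (fun e : Fin n ≃o Fin n => e i) this

lemma eq_atomic_of_length_eq (c : OrderedFinpartition n) (h : c.length = n) : c = atomic n := by
  have hsum := c.sum_partSize
  obtain ⟨l, ps, pos, emb, mono, parts, disj, cov⟩ := c
  dsimp at h hsum
  subst h
  have hps : ps = fun _ => 1 := by
    have h1 : ∑ i, ps i = ∑ i : Fin l, 1 := by simpa using hsum
    funext i
    exact ((Finset.sum_eq_sum_iff_of_le (fun i _ => pos i)).1 h1.symm i (Finset.mem_univ i)).symm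
  subst hps
  have hemb : emb = fun m _ => m := by
    have := strictMono_fin_eq_self parts
    funext m i
    have h2 := congrFun this m
    rw [← h2]
    congr 1
    exact Subsingleton.elim _ _
  subst hemb
  rfl

lemma eq_indiscrete_of_length_eq_one (c : OrderedFinpartition n) (hn : 0 < n)
    (h : c.length = 1) : c = indiscrete n hn := by
  have hsum := c.sum_partSize
  obtain ⟨l, ps, pos, emb, mono, parts, disj, cov⟩ := c
  dsimp at h hsum
  subst h
  have hps : ps = fun _ => n := by
    funext i
    rw [Subsingleton.elim i 0]
    simpa using hsum
  subst hps
  have hemb : emb = fun _ i => i := by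
    funext m
    exact strictMono_fin_eq_self (mono m)
  subst hemb
  rfl

/-- A partition with at least two and fewer than `n` parts has a part of size strictly between
`1` and `n`. -/
lemma exists_partSize_mem_Ioo (c : OrderedFinpartition n) (h1 : 1 < c.length)
    (h2 : c.length < n) : ∃ i, 1 < c.partSize i ∧ c.partSize i < n := by
  have hlt : ∀ i, c.partSize i < n := by
    intro i
    obtain ⟨j, hj⟩ : ∃ j, j ≠ i := by
      have : Nontrivial (Fin c.length) := Fin.nontrivial_iff_two_le.2 h1
      exact exists_ne i
    have := Finset.add_le_sum (f := c.partSize) (s := Finset.univ) (fun _ _ => Nat.zero_le _)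
      (Finset.mem_univ i) (Finset.mem_univ j) hj.symm
    rw [c.sum_partSize] at this
    have := c.partSize_pos j
    omega
  by_contra! hcon
  have : ∑ i, c.partSize i ≤ ∑ _i : Fin c.length, 1 := by
    refine Finset.sum_le_sum fun i _ => ?_
    by_contra! h
    exact absurd (hlt i) (not_lt.2 (hcon i h))
  rw [c.sum_partSize] at this
  simp at this
  omega

end OrderedFinpartition

/-! ### Higher derivatives of compositions, and their symmetry -/

/-- The invariance of the last `n + 1` arguments and of the transposition of the first two arguments
gives full symmetry. -/
theorem apply_perm_of_apply_swap_of_apply_cons {E F : Type*} {n : ℕ} {A : (Fin (n + 2) → E) → F}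
    (hswap : ∀ v, A (fun i => v (Equiv.swap 0 1 i)) = A v)
    (hcons : ∀ (e : Equiv.Perm (Fin (n + 1))) (a : E) (w : Fin (n + 1) → E),
      A (Fin.cons a fun i => w (e i)) = A (Fin.cons a w))
    (σ : Equiv.Perm (Fin (n + 2))) (v : Fin (n + 2) → E) : A (fun i => v (σ i)) = A v := by
  have hfix : ∀ (τ : Equiv.Perm (Fin (n + 2))), τ 0 = 0 → ∀ v, A (fun i => v (τ i)) = A v := by
    intro τ hτ v
    obtain ⟨⟨p, e⟩, rfl⟩ := Equiv.Perm.decomposeFin.symm.surjective τ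
    obtain rfl : p = 0 := by simpa using hτ
    have := hcons e (v 0) (fun i => v i.succ)
    convert this using 2
    · funext i
      refine Fin.cases ?_ (fun i => ?_) i <;> simp
    · funext i
      refine Fin.cases ?_ (fun i => ?_) i <;> simp
  have hsw : ∀ (p : Fin (n + 2)) v, A (fun i => v (Equiv.swap 0 p i)) = A v := by
    intro p v
    rcases eq_or_ne p 0 with rfl | hp
    · simp
    -- The conjugating transposition fixes `0`, so it is covered by `hfix`.
    have key : Equiv.swap 0 p = Equiv.swap 1 p * Equiv.swap 0 1 * Equiv.swap 1 p := by
      have h := Equiv.mul_swap_eq_swap_mul (Equiv.swap 1 p) (0 : Fin (n + 2)) 1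
      rw [h, Equiv.swap_apply_left, Equiv.swap_apply_of_ne_of_ne (by simp) hp.symm, mul_assoc,
        Equiv.swap_mul_self, mul_one]
    have h0 : Equiv.swap 1 p (0 : Fin (n + 2)) = 0 :=
      Equiv.swap_apply_of_ne_of_ne (by simp) hp.symm
    rw [key]
    simp only [Equiv.Perm.mul_apply]
    rw [hfix (Equiv.swap 1 p) h0 (fun i => v (Equiv.swap 1 p (Equiv.swap 0 1 i))),
      hswap (fun i => v (Equiv.swap 1 p i)), hfix _ h0]
  obtain ⟨⟨p, e⟩, rfl⟩ := Equiv.Perm.decomposeFin.symm.surjective σ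
  have hdec : Equiv.Perm.decomposeFin.symm (p, e) =
      Equiv.swap 0 p * Equiv.Perm.decomposeFin.symm (0, e) := by
    ext i
    refine Fin.cases ?_ (fun i => ?_) i <;> simp
  rw [hdec]
  simp only [Equiv.Perm.mul_apply]
  rw [hfix _ (by simp) (fun i => v (Equiv.swap 0 p i)), hsw]

section HigherDerivatives

variable {D E F G : Type*} [NormedAddCommGroup D] [NormedSpace ℝ D]
  [NormedAddCommGroup E] [NormedSpace ℝ E]
  [NormedAddCommGroup F] [NormedSpace ℝ F] [NormedAddCommGroup G] [NormedSpace ℝ G]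

/-- The derivative of order `p ≥ 2` of a composition, if the derivatives of intermediate order of
one of the factors vanish. -/
theorem iteratedFDeriv_comp_of_intermediate_eq_zero {g : E → F} {f : D → E} {x : D} {p : ℕ}
    (hp : 2 ≤ p) (hg : ContDiffAt ℝ p g (f x)) (hf : ContDiffAt ℝ p f x)
    (h : (∀ k, 2 ≤ k → k < p → iteratedFDeriv ℝ k g (f x) = 0) ∨
      (∀ k, 2 ≤ k → k < p → iteratedFDeriv ℝ k f x = 0)) (v : Fin p → D) :
    iteratedFDeriv ℝ p (fun y => g (f y)) x v =
      iteratedFDeriv ℝ p g (f x) (fun i => fderiv ℝ f x (v i)) +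
        fderiv ℝ g (f x) (iteratedFDeriv ℝ p f x v) := by
  classical
  have h0 : 0 < p := by omega
  have hne : OrderedFinpartition.atomic p ≠ OrderedFinpartition.indiscrete p h0 := by
    intro e
    have := congrArg OrderedFinpartition.length e
    simp at this
    omega
  change iteratedFDeriv ℝ p (g ∘ f) x v = _
  -- In Faà di Bruno's formula, a partition that is neither all singletons nor a single block has an
  -- intermediate number of parts, which kills the factor from `g`, and a part of intermediate size,
  -- which kills the factor from `f`. Either hypothesis leaves only the two extreme terms.
  rw [iteratedFDeriv_comp hg hf le_rfl, FormalMultilinearSeries.taylorComp,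
    sum_apply,
    ← Finset.sum_subset (Finset.subset_univ {OrderedFinpartition.atomic p,
      OrderedFinpartition.indiscrete p h0}), Finset.sum_pair hne]
  · congr 1
    · simp only [FormalMultilinearSeries.compAlongOrderedFinpartition_apply, ftaylorSeries]
      change iteratedFDeriv ℝ p g (f x) _ = _
      congr 1
      funext i
      exact iteratedFDeriv_one_apply (𝕜 := ℝ) (f := f) (x := x) fun _ => v i
    · simp only [FormalMultilinearSeries.compAlongOrderedFinpartition_apply, ftaylorSeries]
      exact iteratedFDeriv_one_apply (𝕜 := ℝ) (f := g) (x := f x) fun _ => iteratedFDeriv ℝ p f x v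
  · intro c _ hc
    simp only [Finset.mem_insert, Finset.mem_singleton, not_or] at hc
    have hl1 : 1 < c.length := by
      have := c.length_pos h0
      have : c.length ≠ 1 := fun e => hc.2 (c.eq_indiscrete_of_length_eq_one h0 e)
      omega
    have hl2 : c.length < p :=
      lt_of_le_of_ne c.length_le fun e => hc.1 (c.eq_atomic_of_length_eq e)
    simp only [FormalMultilinearSeries.compAlongOrderedFinpartition_apply, ftaylorSeries]
    rcases h with h | h
    · rw [h _ hl1 hl2]
      rfl
    · obtain ⟨i, hi1, hi2⟩ := c.exists_partSize_mem_Ioo hl1 hl2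
      refine ContinuousMultilinearMap.map_coord_zero _ i ?_
      simp only [OrderedFinpartition.applyOrderedFinpartition_apply]
      rw [h _ hi1 hi2]
      rfl

/-- The derivatives of a smooth function are symmetric. -/
theorem iteratedFDeriv_comp_perm_of_contDiffAt {n : ℕ} {f : E → F} {x : E}
    (hf : ContDiffAt ℝ n f x) (σ : Equiv.Perm (Fin n)) (v : Fin n → E) :
    iteratedFDeriv ℝ n f x (fun i => v (σ i)) = iteratedFDeriv ℝ n f x v := by
  match n with
  | 0 => exact congrArg _ (Subsingleton.elim _ _)
  | 1 =>
    rw [Subsingleton.elim σ 1]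
    rfl
  | n + 2 =>
    refine apply_perm_of_apply_swap_of_apply_cons (A := iteratedFDeriv ℝ (n + 2) f x) ?_ ?_ σ v
    · have h2 : ContDiffAt ℝ 2 (iteratedFDeriv ℝ n f) x :=
        hf.iteratedFDeriv_right (by norm_cast; omega)
      have hd : DifferentiableAt ℝ (fderiv ℝ (iteratedFDeriv ℝ n f)) x :=
        (h2.fderiv_right (m := 1) (by norm_num)).differentiableAt (by norm_num)
      have hsymm : IsSymmSndFDerivAt ℝ (iteratedFDeriv ℝ n f) x :=
        h2.isSymmSndFDerivAt (by simp)
      have hexp : ∀ v : Fin (n + 2) → E, iteratedFDeriv ℝ (n + 2) f x v =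
          fderiv ℝ (fderiv ℝ (iteratedFDeriv ℝ n f)) x (v 0) (v 1) (Fin.tail (Fin.tail v)) := by
        intro v
        have hd' : DifferentiableAt ℝ (iteratedFDeriv ℝ (n + 1) f) x :=
          (hf.iteratedFDeriv_right (m := 1) (by norm_cast; omega)).differentiableAt (by norm_num)
        rw [hd'.iteratedFDeriv_succ_apply_left']
        have h1 : HasFDerivAt (fun y => fderiv ℝ (iteratedFDeriv ℝ n f) y (v 1))
            ((fderiv ℝ (fderiv ℝ (iteratedFDeriv ℝ n f)) x).flip (v 1)) x := by
          simpa using hd.hasFDerivAt.clm_apply (hasFDerivAt_const (v 1) x)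
        change fderiv ℝ (fun y => fderiv ℝ (iteratedFDeriv ℝ n f) y (v 1)
          (Fin.tail (Fin.tail v))) x (v 0) = _
        rw [fderiv_continuousMultilinear_apply_const h1.differentiableAt, h1.fderiv]
        rfl
      intro v
      rw [hexp, hexp]
      simp only [Equiv.swap_apply_left, Equiv.swap_apply_right]
      rw [hsymm.eq]
      congr 1
    · intro e a w
      have hd : DifferentiableAt ℝ (iteratedFDeriv ℝ (n + 1) f) x :=
        (hf.iteratedFDeriv_right (m := 1) (by norm_cast; omega)).differentiableAt (by norm_num)
      rw [hd.iteratedFDeriv_succ_apply_left', hd.iteratedFDeriv_succ_apply_left']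
      simp only [Fin.tail_cons, Fin.cons_zero]
      -- The induction hypothesis is needed at all points near `x`, since the identity is then
      -- differentiated.
      have hev : (fun y => iteratedFDeriv ℝ (n + 1) f y (fun i => w (e i))) =ᶠ[𝓝 x]
          fun y => iteratedFDeriv ℝ (n + 1) f y w := by
        have hf' : ContDiffAt ℝ ((n + 1 : ℕ) : WithTop ℕ∞) f x :=
          hf.of_le (by norm_cast; omega)
        filter_upwards [hf'.eventually (by simp)] with y hy
        exact iteratedFDeriv_comp_perm_of_contDiffAt hy e w
      rw [hev.fderiv_eq]
  termination_by n

end HigherDerivatives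

/-! ### Polynomials with a prescribed leading derivative -/

section HigherDerivatives

variable {E F : Type*} [NormedAddCommGroup E] [NormedSpace ℝ E]
  [NormedAddCommGroup F] [NormedSpace ℝ F]

lemma iteratedFDeriv_id_of_two_le {k : ℕ} (hk : 2 ≤ k) (x : E) :
    iteratedFDeriv ℝ k (id : E → E) x = 0 := by
  obtain ⟨k, rfl⟩ := Nat.exists_eq_add_of_le' (show 1 ≤ k by omega)
  ext1 v
  rw [iteratedFDeriv_succ_apply_right]
  simp only [fderiv_id]
  rw [iteratedFDeriv_const_of_ne (by omega)]
  rfl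

lemma iteratedFDeriv_one_eq_iff {f g : E → F} {x : E} :
    iteratedFDeriv ℝ 1 f x = iteratedFDeriv ℝ 1 g x ↔ fderiv ℝ f x = fderiv ℝ g x := by
  constructor
  · intro h
    ext v
    simpa using DFunLike.congr_fun h fun _ => v
  · intro h
    ext v
    simp [h]

lemma iteratedFDeriv_zero_eq_iff {f g : E → F} {x : E} :
    iteratedFDeriv ℝ 0 f x = iteratedFDeriv ℝ 0 g x ↔ f x = g x := by
  constructor
  · intro h
    simpa using DFunLike.congr_fun h ![]
  · intro h
    ext v
    simp [h]

/-- The homogeneous polynomial `w ↦ N(w - z, …, w - z) / q!`. -/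
noncomputable def homogeneousPoly {q : ℕ} (N : E [×q]→L[ℝ] F) (z w : E) : F :=
  (q.factorial : ℝ)⁻¹ • N fun _ => w - z

lemma contDiff_homogeneousPoly {q : ℕ} (N : E [×q]→L[ℝ] F) (z : E) {r : WithTop ℕ∞} :
    ContDiff ℝ r (homogeneousPoly N z) := by
  unfold homogeneousPoly
  exact contDiff_const.smul (N.contDiff.comp (contDiff_pi.2 fun _ => contDiff_id.sub contDiff_const))

lemma hasFPowerSeriesOnBall_homogeneousPoly {q : ℕ} (N : E [×q]→L[ℝ] F) (z : E) :
    HasFPowerSeriesOnBall (homogeneousPoly N z)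
      (Pi.single q ((q.factorial : ℝ)⁻¹ • N) : (k : ℕ) → E [×k]→L[ℝ] F) z ⊤ where
  r_le := by
    refine top_le_iff.2 ?_
    refine FormalMultilinearSeries.radius_eq_top_of_forall_image_add_eq_zero _ (q + 1) fun k => ?_
    exact Pi.single_eq_of_ne (by omega) _
  r_pos := ENNReal.zero_lt_top
  hasSum := by
    intro y _
    have := hasSum_single (f := fun k : ℕ =>
      (Pi.single q ((q.factorial : ℝ)⁻¹ • N) : (k : ℕ) → E [×k]→L[ℝ] F) k fun _ => y) q
      (fun k hk => by simp [Pi.single_eq_of_ne hk])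
    simpa [homogeneousPoly] using this

variable [CompleteSpace F]

/-- The derivative of order `q` is the sum of the series coefficient over all `q!` permutations of
its arguments; symmetry makes the summands equal and the factor `1 / q!` cancels. -/
lemma iteratedFDeriv_homogeneousPoly_self {q : ℕ} {N : E [×q]→L[ℝ] F}
    (hN : ∀ (σ : Equiv.Perm (Fin q)) (v : Fin q → E), N (fun i => v (σ i)) = N v) (z : E) :
    iteratedFDeriv ℝ q (homogeneousPoly N z) z = N := by
  ext v
  rw [(hasFPowerSeriesOnBall_homogeneousPoly N z).iteratedFDeriv_eq_sum_of_completeSpace]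
  simp only [Pi.single_eq_same, smul_apply, hN, Finset.sum_const,
    Finset.card_univ, Fintype.card_perm, Fintype.card_fin]
  rw [← Nat.cast_smul_eq_nsmul ℝ, smul_smul, mul_inv_cancel₀ (by positivity), one_smul]

lemma iteratedFDeriv_homogeneousPoly_of_ne {q k : ℕ} (N : E [×q]→L[ℝ] F) (z : E) (hk : k ≠ q) :
    iteratedFDeriv ℝ k (homogeneousPoly N z) z = 0 := by
  ext v
  rw [(hasFPowerSeriesOnBall_homogeneousPoly N z).iteratedFDeriv_eq_sum_of_completeSpace]
  simp [Pi.single_eq_of_ne hk]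

end HigherDerivatives

/-! ### Local diffeomorphisms from the inverse function theorem -/

namespace LiePseudoGroup

variable {n m : ℕ}

/-- A map which is smooth near `z` with invertible derivative at `z` restricts to a local
diffeomorphism near `z`. -/
theorem exists_diffeo_of_contDiffAt {E : Set (Coord n m)} (hE : IsOpen E)
    {f : Coord n m → Coord n m} {z : Coord n m} (hf : ∀ᶠ w in 𝓝 z, ContDiffAt ℝ ∞ f w)
    (hf' : IsUnit (fderiv ℝ f z)) (hz : z ∈ E) (hfz : f z ∈ E) :
    ∃ φ ∈ diffeoPseudoGroup E, z ∈ φ.source ∧ ⇑φ = f := by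
  obtain ⟨u, hu⟩ := hf'
  have hfz' := hf.self_of_nhds
  have hd : HasFDerivAt f (ContinuousLinearEquiv.ofUnit u : Coord n m →L[ℝ] Coord n m) z := by
    have : (ContinuousLinearEquiv.ofUnit u : Coord n m →L[ℝ] Coord n m) = fderiv ℝ f z := hu
    rw [this]
    exact (hfz'.differentiableAt (by simp)).hasFDerivAt
  let φ := hfz'.toOpenPartialHomeomorph f hd (by simp)
  have hφ : ⇑φ = f := hfz'.toOpenPartialHomeomorph_coe hd (by simp)
  have hzφ : z ∈ φ.source := hfz'.mem_toOpenPartialHomeomorph_source hd (by simp)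
  have hunit : ∀ᶠ w in 𝓝 z, IsUnit (fderiv ℝ f w) := by
    have hc : ContinuousAt (fderiv ℝ f) z :=
      (hfz'.fderiv_right (m := 0) (by simp)).continuousAt
    exact hc.eventually (Units.isOpen.mem_nhds (⟨u, hu⟩ : IsUnit (fderiv ℝ f z)))
  -- Invertibility is kept on a whole neighbourhood because the inverse must be smooth on the entire
  -- target.
  have hgood : ∀ᶠ w in 𝓝 z, ContDiffAt ℝ ∞ f w ∧ IsUnit (fderiv ℝ f w) ∧ w ∈ E ∧ f w ∈ E :=
    hf.and (hunit.and ((hE.eventually_mem hz).and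
      (hfz'.continuousAt.eventually (hE.mem_nhds hfz))))
  obtain ⟨s, hs, hso, hzs⟩ := eventually_nhds_iff.1 hgood
  have hsrc : (φ.restr s).source = φ.source ∩ s := φ.restr_source' s hso
  refine ⟨φ.restr s, ⟨?_, ?_, ?_, ?_⟩, ?_, hφ⟩
  · rw [hsrc]
    exact fun w hw => (hs w hw.2).2.2.1
  · intro y hy
    have h1 := (φ.restr s).map_target hy
    rw [hsrc] at h1
    have h2 := (hs _ h1.2).2.2.2
    have h3 := (φ.restr s).right_inv hy
    rw [show (φ.restr s) ((φ.restr s).symm y) = f ((φ.restr s).symm y) from congrFun hφ _] at h3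
    rwa [h3] at h2
  · rw [hsrc]
    intro w hw
    have : ⇑(φ.restr s) = f := hφ
    rw [this]
    exact (hs w hw.2).1.contDiffWithinAt
  · intro y hy
    have h1 := (φ.restr s).map_target hy
    rw [hsrc] at h1
    obtain ⟨hc, ⟨v, hv⟩, -, -⟩ := hs _ h1.2
    refine ((φ.restr s).contDiffAt_symm (f₀' := ContinuousLinearEquiv.ofUnit v) hy ?_ ?_
      ).contDiffWithinAt
    · have h4 : ⇑(φ.restr s) = f := hφ
      rw [h4, show ((ContinuousLinearEquiv.ofUnit v : Coord n m →L[ℝ] Coord n m)) =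
        fderiv ℝ f ((φ.restr s).symm y) from hv]
      exact (hc.differentiableAt (by simp)).hasFDerivAt
    · have h4 : ⇑(φ.restr s) = f := hφ
      rw [h4]
      exact hc
  · rw [hsrc]
    exact ⟨hzφ, hzs⟩

end LiePseudoGroup

/-! ### The fiber of `H_q` over an identity jet and its composition law -/

namespace LiePseudoGroup

variable {n m : ℕ}

/-- The jet obtained from the `q`-jet of the identity at `z` by adding `N` to the derivative of
order `q`. -/
noncomputable def idJetAdd {q : ℕ} (z : Coord n m) (N : Coord n m [×q]→L[ℝ] Coord n m) :
    MapJet n m q :=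
  mapJet q id z + (0, Pi.single (Fin.last q) N)

lemma continuous_idJetAdd {q : ℕ} (z : Coord n m) :
    Continuous (idJetAdd (q := q) z) := by
  unfold idJetAdd
  exact continuous_const.add (continuous_const.prodMk (continuous_single
    (A := fun k : Fin (q + 1) => Coord n m [×(k : ℕ)]→L[ℝ] Coord n m) (Fin.last q)))

lemma idJetAdd_zero {q : ℕ} (z : Coord n m) :
    idJetAdd z (0 : Coord n m [×q]→L[ℝ] Coord n m) = mapJet q id z := by
  simp [idJetAdd]

lemma idJetAdd_eq_mapJet_id_iff {q : ℕ} {z : Coord n m} {N : Coord n m [×q]→L[ℝ] Coord n m} :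
    idJetAdd z N = mapJet q id z ↔ N = 0 := by
  unfold idJetAdd
  rw [add_eq_left, Prod.mk_eq_zero]
  simp

lemma eq_idJetAdd_iff {q : ℕ} {φ : Coord n m → Coord n m} {w z : Coord n m}
    {N : Coord n m [×q]→L[ℝ] Coord n m} :
    mapJet q φ w = idJetAdd z N ↔ w = z ∧
      (∀ k < q, iteratedFDeriv ℝ k φ z = iteratedFDeriv ℝ k id z) ∧
      iteratedFDeriv ℝ q φ z = iteratedFDeriv ℝ q id z + N := by
  constructor
  · intro h
    obtain rfl : w = z := by simpa [mapJet, idJetAdd] using congrArg Prod.fst h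
    refine ⟨rfl, fun k hk => ?_, ?_⟩
    · have := congrFun (congrArg Prod.snd h) ⟨k, by omega⟩
      have hne : (⟨k, by omega⟩ : Fin (q + 1)) ≠ Fin.last q := by
        intro h
        have := congrArg Fin.val h
        simp at this
        omega
      simpa [mapJet, idJetAdd, Pi.single_eq_of_ne hne] using this
    · have := congrFun (congrArg Prod.snd h) (Fin.last q)
      simpa [mapJet, idJetAdd] using this
  · rintro ⟨rfl, h1, h2⟩
    refine Prod.ext (by simp [mapJet, idJetAdd]) (funext fun k => ?_)
    rcases eq_or_ne k (Fin.last q) with rfl | hk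
    · simpa [mapJet, idJetAdd] using h2
    · have hk' : (k : ℕ) < q := by
        have := k.2
        have : (k : ℕ) ≠ q := fun h => hk (Fin.ext h)
        omega
      simpa [mapJet, idJetAdd, Pi.single_eq_of_ne hk] using h1 k hk'

/-- The order `q` parts of the elements of `H_q` at `z` lying over the identity jet of
order `q - 1`. -/
def fiber (H : Set (OpenPartialHomeomorph (Coord n m) (Coord n m))) (q : ℕ) (z : Coord n m) :
    Set (Coord n m [×q]→L[ℝ] Coord n m) :=
  {N | idJetAdd z N ∈ jets H q}

lemma mem_fiber_iff {H : Set (OpenPartialHomeomorph (Coord n m) (Coord n m))} {q : ℕ}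
    {z : Coord n m} {N : Coord n m [×q]→L[ℝ] Coord n m} :
    N ∈ fiber H q z ↔ ∃ φ ∈ H, z ∈ φ.source ∧
      (∀ k < q, iteratedFDeriv ℝ k φ z = iteratedFDeriv ℝ k id z) ∧
      iteratedFDeriv ℝ q φ z = iteratedFDeriv ℝ q id z + N := by
  constructor
  · rintro ⟨φ, hφ, w, hw, h⟩
    obtain ⟨rfl, h1, h2⟩ := eq_idJetAdd_iff.1 h.symm
    exact ⟨φ, hφ, hw, h1, h2⟩
  · rintro ⟨φ, hφ, hz, h1, h2⟩
    exact ⟨φ, hφ, z, hz, (eq_idJetAdd_iff.2 ⟨rfl, h1, h2⟩).symm⟩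

lemma contDiffAt_of_mem_diffeo {E : Set (Coord n m)}
    {φ : OpenPartialHomeomorph (Coord n m) (Coord n m)} (hφ : φ ∈ diffeoPseudoGroup E)
    {z : Coord n m} (hz : z ∈ φ.source) : ContDiffAt ℝ ∞ φ z :=
  hφ.2.2.1.contDiffAt (φ.open_source.mem_nhds hz)

lemma fderiv_eq_id_of_iteratedFDeriv {φ : Coord n m → Coord n m} {z : Coord n m}
    (h : iteratedFDeriv ℝ 1 φ z = iteratedFDeriv ℝ 1 id z) :
    fderiv ℝ φ z = ContinuousLinearMap.id ℝ _ := by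
  rw [iteratedFDeriv_one_eq_iff.1 h, fderiv_id]

variable {E : Set (Coord n m)} {H : Set (OpenPartialHomeomorph (Coord n m) (Coord n m))}

/-- Both maps fix `z` with identity linear part and vanishing derivatives of orders strictly between
`1` and `q`. Only the extreme terms of the composition formula survive, so composing adds the
leading parts. -/
theorem add_mem_fiber (hH : IsPseudoGroup E H) {q : ℕ} (hq : 2 ≤ q) {z : Coord n m}
    {M N : Coord n m [×q]→L[ℝ] Coord n m} (hM : M ∈ fiber H q z) (hN : N ∈ fiber H q z) :
    M + N ∈ fiber H q z := by
  obtain ⟨φ, hφ, hz, h1, h2⟩ := mem_fiber_iff.1 hM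
  obtain ⟨ψ, hψ, hz', h1', h2'⟩ := mem_fiber_iff.1 hN
  have hφz : φ z = z := iteratedFDeriv_zero_eq_iff.1 (h1 0 (by omega))
  have hψz : ψ z = z := iteratedFDeriv_zero_eq_iff.1 (h1' 0 (by omega))
  have hdφ := fderiv_eq_id_of_iteratedFDeriv (h1 1 (by omega))
  have hdψ := fderiv_eq_id_of_iteratedFDeriv (h1' 1 (by omega))
  have hcφ := contDiffAt_of_mem_diffeo (hH.subset hφ) hz
  have hcψ := contDiffAt_of_mem_diffeo (hH.subset hψ) hz'
  have hcomp : ∀ k, 2 ≤ k → k ≤ q → iteratedFDeriv ℝ k (φ.trans ψ) z =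
      iteratedFDeriv ℝ k φ z + iteratedFDeriv ℝ k ψ z := by
    intro k hk hkq
    refine DFunLike.ext _ _ fun v => ?_
    have hcψ' : ContDiffAt ℝ k ψ (φ z) := by
      rw [hφz]
      exact hcψ.of_le (by exact_mod_cast le_top)
    have := iteratedFDeriv_comp_of_intermediate_eq_zero hk hcψ'
      (hcφ.of_le (by exact_mod_cast le_top))
      (Or.inr fun j hj hjk => by rw [h1 j (by omega), iteratedFDeriv_id_of_two_le hj]) v
    rw [hφz, hdφ, hdψ] at this
    change iteratedFDeriv ℝ k (fun y => ψ (φ y)) z v = _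
    rw [this, add_comm]
    rfl
  refine mem_fiber_iff.2 ⟨φ.trans ψ, hH.trans_mem φ hφ ψ hψ, ?_, ?_, ?_⟩
  · rw [φ.trans_source]
    exact ⟨hz, by simpa [hφz] using hz'⟩
  · intro k hk
    match k with
    | 0 =>
      rw [iteratedFDeriv_zero_eq_iff]
      simp [hφz, hψz]
    | 1 =>
      rw [iteratedFDeriv_one_eq_iff, fderiv_id]
      change fderiv ℝ (ψ ∘ φ) z = _
      rw [fderiv_comp z (by rw [hφz]; exact hcψ.differentiableAt (by simp))
        (hcφ.differentiableAt (by simp)), hφz, hdφ, hdψ]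
      rfl
    | k + 2 =>
      rw [hcomp _ (by omega) hk.le, h1 _ hk, h1' _ hk, iteratedFDeriv_id_of_two_le (by omega),
        add_zero]
  · rw [hcomp _ hq le_rfl, h2, h2', iteratedFDeriv_id_of_two_le hq, zero_add, zero_add, zero_add]

/-- A linear map as an array of order one. -/
noncomputable abbrev toOrderOne (A : Coord n m →L[ℝ] Coord n m) :
    Coord n m [×1]→L[ℝ] Coord n m :=
  (continuousMultilinearCurryFin1 ℝ (Coord n m) (Coord n m)).symm A

/-- For `q = 1` the fiber is the linear isotropy at `z` shifted by `-1`, so its composition law is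
multiplicative rather than additive. -/
lemma sub_one_mem_fiber_one_iff {z : Coord n m} {A : Coord n m →L[ℝ] Coord n m} :
    toOrderOne (A - 1) ∈ fiber H 1 z ↔
      ∃ φ ∈ H, z ∈ φ.source ∧ φ z = z ∧ fderiv ℝ φ z = A := by
  rw [mem_fiber_iff]
  refine exists_congr fun φ => and_congr_right fun _ => and_congr_right fun _ => ?_
  refine and_congr ?_ ?_
  · constructor
    · exact fun h => iteratedFDeriv_zero_eq_iff.1 (h 0 zero_lt_one)
    · intro h k hk
      obtain rfl : k = 0 := by omega
      exact iteratedFDeriv_zero_eq_iff.2 h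
  · constructor
    · intro h
      refine DFunLike.ext _ _ fun v => ?_
      simpa using DFunLike.congr_fun h fun _ => v
    · intro h
      refine DFunLike.ext _ _ fun v => ?_
      simp [h]

theorem mul_sub_one_mem_fiber (hH : IsPseudoGroup E H) {z : Coord n m}
    {A B : Coord n m →L[ℝ] Coord n m} (hA : toOrderOne (A - 1) ∈ fiber H 1 z)
    (hB : toOrderOne (B - 1) ∈ fiber H 1 z) : toOrderOne (A * B - 1) ∈ fiber H 1 z := by
  rw [sub_one_mem_fiber_one_iff] at *
  obtain ⟨ψ, hψ, hz', hψz, hdψ⟩ := hA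
  obtain ⟨φ, hφ, hz, hφz, hdφ⟩ := hB
  refine ⟨φ.trans ψ, hH.trans_mem φ hφ ψ hψ, ?_, ?_, ?_⟩
  · rw [φ.trans_source]
    exact ⟨hz, by simpa [hφz] using hz'⟩
  · simp [hφz, hψz]
  · change fderiv ℝ (ψ ∘ φ) z = _
    have hcφ := contDiffAt_of_mem_diffeo (hH.subset hφ) hz
    have hcψ := contDiffAt_of_mem_diffeo (hH.subset hψ) hz'
    rw [fderiv_comp z (by rw [hφz]; exact hcψ.differentiableAt (by simp))
        (hcφ.differentiableAt (by simp)), hφz, hdφ, hdψ]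
    rfl

/-- Symmetry passes to limits of fiber elements, which is what makes small limits realizable by
diffeomorphisms. -/
lemma fiber_symmetric (hH : IsPseudoGroup E H) {q : ℕ} {z : Coord n m}
    {N : Coord n m [×q]→L[ℝ] Coord n m} (hN : N ∈ fiber H q z) (σ : Equiv.Perm (Fin q))
    (v : Fin q → Coord n m) : N (fun i => v (σ i)) = N v := by
  obtain ⟨φ, hφ, hz, -, h2⟩ := mem_fiber_iff.1 hN
  have hcφ := contDiffAt_of_mem_diffeo (hH.subset hφ) hz
  obtain rfl : N = iteratedFDeriv ℝ q φ z - iteratedFDeriv ℝ q id z := by rw [h2]; abel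
  rw [sub_apply, sub_apply, iteratedFDeriv_comp_perm_of_contDiffAt
    (hcφ.of_le (by exact_mod_cast le_top)), iteratedFDeriv_comp_perm_of_contDiffAt contDiffAt_id]

/-- Symmetric perturbations of the identity jet are jets of local diffeomorphisms. -/
theorem eventually_mem_fiber_diffeo (hE : IsOpen E) {q : ℕ} (hq : 1 ≤ q) {z : Coord n m}
    (hz : z ∈ E) : ∀ᶠ N in 𝓝 (0 : Coord n m [×q]→L[ℝ] Coord n m),
      (∀ (σ : Equiv.Perm (Fin q)) (v : Fin q → Coord n m), N (fun i => v (σ i)) = N v) →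
      N ∈ fiber (diffeoPseudoGroup E) q z := by
  have hd : ∀ (N : Coord n m [×q]→L[ℝ] Coord n m) k,
      iteratedFDeriv ℝ k (fun w => id w + homogeneousPoly N z w) z =
        iteratedFDeriv ℝ k id z + iteratedFDeriv ℝ k (homogeneousPoly N z) z := fun N k =>
    fun_iteratedFDeriv_add_apply contDiffAt_id (contDiff_homogeneousPoly N z).contDiffAt
  have hunit : ∀ᶠ N in 𝓝 (0 : Coord n m [×q]→L[ℝ] Coord n m),
      (∀ (σ : Equiv.Perm (Fin q)) (v : Fin q → Coord n m), N (fun i => v (σ i)) = N v) →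
      IsUnit (fderiv ℝ (fun w => id w + homogeneousPoly N z w) z) := by
    -- The array is realized by adding a homogeneous polynomial to the identity. Smallness of `N`
    -- matters only for `q = 1`, where the linear part becomes `1 + N`; for `q ≥ 2` it stays the
    -- identity.
    rcases eq_or_lt_of_le hq with rfl | hq
    · have hc : Continuous fun N : Coord n m [×1]→L[ℝ] Coord n m =>
          1 + continuousMultilinearCurryFin1 ℝ (Coord n m) (Coord n m) N :=
        continuous_const.add (LinearIsometryEquiv.continuous _)
      have h1 : IsUnit (1 + continuousMultilinearCurryFin1 ℝ (Coord n m) (Coord n m) 0) := by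
        simp
      filter_upwards [hc.continuousAt.eventually (Units.isOpen.mem_nhds h1)] with N hN hs
      convert hN using 1
      refine DFunLike.ext _ _ fun v => ?_
      have := DFunLike.congr_fun (hd N 1) ![v]
      rw [iteratedFDeriv_homogeneousPoly_self hs] at this
      simpa using this
    · refine Eventually.of_forall fun N _ => ?_
      rw [fderiv_eq_id_of_iteratedFDeriv]
      · exact isUnit_one
      · rw [hd, iteratedFDeriv_homogeneousPoly_of_ne _ _ (by omega), add_zero]
  filter_upwards [hunit] with N hN hs
  have hk : ∀ k < q, iteratedFDeriv ℝ k (fun w => id w + homogeneousPoly N z w) z =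
      iteratedFDeriv ℝ k id z := fun k hk => by
    rw [hd, iteratedFDeriv_homogeneousPoly_of_ne _ _ hk.ne, add_zero]
  obtain ⟨φ, hφ, hzφ, hφf⟩ := exists_diffeo_of_contDiffAt hE (z := z)
    (Eventually.of_forall fun w =>
      (contDiff_id.add (contDiff_homogeneousPoly N z)).contDiffAt) (hN hs) hz (by
        rwa [iteratedFDeriv_zero_eq_iff.1 (hk 0 hq)])
  refine mem_fiber_iff.2 ⟨φ, hφ, hzφ, ?_, ?_⟩
  · rwa [hφf]
  · rw [hφf, hd, iteratedFDeriv_homogeneousPoly_self hs]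

end LiePseudoGroup

/-! ### One-parameter semigroups as limits of iterates -/

section OneParameter

/-- This is the difference quotient of `s ↦ c (t * s)` at `0` with step `1 / k`. -/
lemma tendsto_natCast_smul_of_hasDerivAt {V : Type*} [NormedAddCommGroup V] [NormedSpace ℝ V]
    {c : ℝ → V} {N : V} (hc0 : c 0 = 0) (hc : HasDerivAt c N 0) (t : ℝ) :
    Tendsto (fun k : ℕ => (k : ℝ) • c (t / k)) atTop (𝓝 (t • N)) := by
  have h1 : HasDerivAt (fun s => c (t * s)) (t • N) 0 := by
    have h2 : HasDerivAt (fun s : ℝ => t * s) t 0 := by simpa using (hasDerivAt_id (0 : ℝ)).const_mul t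
    exact HasDerivAt.scomp (g₁ := c) (g₁' := N) 0 (by simpa using hc) h2
  have h3 := h1.tendsto_slope_zero_right
  have h4 : Tendsto (fun k : ℕ => ((k : ℝ))⁻¹) atTop (𝓝[>] 0) :=
    tendsto_inv_atTop_nhdsGT_zero.comp tendsto_natCast_atTop_atTop
  refine (h3.comp h4).congr fun k => ?_
  simp [hc0, div_eq_mul_inv]

lemma tendsto_div_natCast_zero (t : ℝ) : Tendsto (fun k : ℕ => t / (k : ℝ)) atTop (𝓝 0) :=
  tendsto_const_nhds.div_atTop tendsto_natCast_atTop_atTop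

/-- A locally closed additive semigroup contains the lines tangent to its curves. -/
theorem eventually_smul_mem_of_curve {V : Type*} [NormedAddCommGroup V] [NormedSpace ℝ V]
    {G : Set V} (hadd : ∀ a ∈ G, ∀ b ∈ G, a + b ∈ G) {W : Set V} (hW : W ∈ 𝓝 (0 : V))
    (hclosed : ∀ a ∈ W, a ∈ closure G → a ∈ G) {c : ℝ → V} {N : V} (hc0 : c 0 = 0)
    (hc : HasDerivAt c N 0) (hcG : ∀ᶠ t in 𝓝 0, c t ∈ G) : ∀ᶠ t : ℝ in 𝓝 0, t • N ∈ G := by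
  have hsmul : ∀ a ∈ G, ∀ k : ℕ, 1 ≤ k → (k : ℝ) • a ∈ G := by
    intro a ha k hk
    induction k, hk using Nat.le_induction with
    | base => simpa using ha
    | succ k _ ih =>
      rw [Nat.cast_succ, add_smul, one_smul]
      exact hadd _ ih _ ha
  have hW' : ∀ᶠ t : ℝ in 𝓝 0, t • N ∈ W := by
    have : Continuous fun t : ℝ => t • N := by fun_prop
    exact this.continuousAt.eventually (by simpa using hW)
  filter_upwards [hW'] with t ht
  -- The approximants `k • c (t / k)` are `k`-fold sums in `G`. They need not lie in `W`; only the
  -- limit must.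
  refine hclosed _ ht (mem_closure_of_tendsto (tendsto_natCast_smul_of_hasDerivAt hc0 hc t) ?_)
  filter_upwards [(tendsto_div_natCast_zero t).eventually hcG, eventually_ge_atTop 1] with k hk h1
  exact hsmul _ hk k h1

variable {A : Type*} [NormedRing A] [NormOneClass A]

/-- Telescoping. It is applied with a bound of the form `1 + C / k`, whose `k`-th power stays below
`Real.exp C`. -/
lemma norm_pow_sub_pow_le_of_norm_le {a b : A} {C : ℝ} (hC : 1 ≤ C) (ha : ‖a‖ ≤ C) (hb : ‖b‖ ≤ C)
    (k : ℕ) : ‖a ^ k - b ^ k‖ ≤ k * ‖a - b‖ * C ^ k := by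
  have hC0 : 0 ≤ C := zero_le_one.trans hC
  induction k with
  | zero => simp
  | succ k ih =>
    have h1 : a ^ (k + 1) - b ^ (k + 1) = a ^ k * (a - b) + (a ^ k - b ^ k) * b := by
      rw [pow_succ, pow_succ]
      noncomm_ring
    have h2 : ‖a ^ k‖ ≤ C ^ (k + 1) :=
      ((norm_pow_le a k).trans (pow_le_pow_left₀ (norm_nonneg _) ha k)).trans
        (pow_le_pow_right₀ hC (Nat.le_succ k))
    calc ‖a ^ (k + 1) - b ^ (k + 1)‖ ≤ ‖a ^ k‖ * ‖a - b‖ + ‖a ^ k - b ^ k‖ * ‖b‖ := by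
          rw [h1]
          exact (norm_add_le _ _).trans (add_le_add (norm_mul_le _ _) (norm_mul_le _ _))
      _ ≤ C ^ (k + 1) * ‖a - b‖ + (k * ‖a - b‖ * C ^ k) * C := by gcongr
      _ = ((k + 1 : ℕ) : ℝ) * ‖a - b‖ * C ^ (k + 1) := by
          push_cast
          ring

variable [NormedAlgebra ℝ A] [CompleteSpace A]

/-- The limit formula `(1 + c(t / k)) ^ k → exp (t c'(0))`. -/
theorem tendsto_one_add_pow_exp_of_hasDerivAt {c : ℝ → A} {N : A} (hc0 : c 0 = 0)
    (hc : HasDerivAt c N 0) (t : ℝ) :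
    Tendsto (fun k : ℕ => (1 + c (t / k)) ^ k) atTop (𝓝 (NormedSpace.exp (t • N))) := by
  have hexp : HasDerivAt (fun s : ℝ => NormedSpace.exp (s • N) - 1) N 0 := by
    simpa using (hasDerivAt_exp_smul_const (𝕂 := ℝ) N (0 : ℝ)).sub_const 1
  have hlim1 := tendsto_natCast_smul_of_hasDerivAt hc0 hc t
  have hlim2 := tendsto_natCast_smul_of_hasDerivAt
    (c := fun s : ℝ => NormedSpace.exp (s • N) - 1) (by simp) hexp t
  -- The curves `c` and `s ↦ exp (s • N) - 1` have the same value and derivative at `0`, so they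
  -- differ by `o(1 / k)` at `t / k`.
  have hdiff : Tendsto (fun k : ℕ => (k : ℝ) * ‖(1 + c (t / k)) -
      NormedSpace.exp ((t / (k : ℝ)) • N)‖) atTop (𝓝 0) := by
    have := (hlim1.sub hlim2).norm
    simp only [sub_self, norm_zero] at this
    refine this.congr fun k => ?_
    rw [← smul_sub, norm_smul, Real.norm_natCast]
    congr 2
    abel
  -- Any constant above the limit norm would do: it eventually bounds `k * ‖d (t / k)‖` for both
  -- curves.
  set C : ℝ := ‖t • N‖ + 1 with hCdef
  have hbd : ∀ {d : ℝ → A}, Tendsto (fun k : ℕ => (k : ℝ) • d (t / k)) atTop (𝓝 (t • N)) →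
      ∀ᶠ k : ℕ in atTop, ‖1 + d (t / k)‖ ≤ 1 + C / k := by
    intro d hd
    filter_upwards [hd.norm.eventually_lt_const (lt_add_one _), eventually_ge_atTop 1] with k hk h1
    have hk0 : (0 : ℝ) < k := by exact_mod_cast h1
    refine (norm_add_le _ _).trans ?_
    rw [norm_one]
    rw [norm_smul, Real.norm_natCast] at hk
    have : ‖d (t / k)‖ ≤ C / k := by
      rw [le_div_iff₀ hk0, mul_comm]
      exact hk.le
    linarith
  have hC0 : 0 ≤ C := by positivity
  have hmain : Tendsto (fun k : ℕ => (1 + c (t / k)) ^ k -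
      NormedSpace.exp ((t / (k : ℝ)) • N) ^ k) atTop (𝓝 0) := by
    refine squeeze_zero_norm' (a := fun k : ℕ => ((k : ℝ) * ‖(1 + c (t / k)) -
      NormedSpace.exp ((t / (k : ℝ)) • N)‖) * Real.exp C) ?_ (by simpa using hdiff.mul_const _)
    filter_upwards [hbd hlim1, hbd (d := fun s : ℝ => NormedSpace.exp (s • N) - 1) hlim2, eventually_ge_atTop 1] with k h1 h2 hk
    have hk0 : (0 : ℝ) < k := by exact_mod_cast hk
    simp only [add_sub_cancel] at h2
    refine (norm_pow_sub_pow_le_of_norm_le (by simp; positivity) h1 h2 k).trans ?_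
    gcongr
    calc (1 + C / k) ^ k ≤ Real.exp (C / k) ^ k := by
          gcongr
          rw [add_comm]
          exact Real.add_one_le_exp _
      _ = Real.exp C := by
          rw [← Real.exp_nat_mul]
          congr 1
          field_simp
  have := hmain.add_const (NormedSpace.exp (t • N))
  rw [zero_add] at this
  refine this.congr' ?_
  filter_upwards [eventually_ge_atTop 1] with k hk
  have hk0 : (k : ℝ) ≠ 0 := by
    have : k ≠ 0 := by omega
    exact_mod_cast this
  let : NormedAlgebra ℚ A := NormedAlgebra.restrictScalars ℚ ℝ A
  rw [← NormedSpace.exp_nsmul, ← Nat.cast_smul_eq_nsmul ℝ, smul_smul, mul_div_cancel₀ _ hk0]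
  abel

/-- A locally closed multiplicative semigroup contains the one-parameter groups tangent to its
curves. -/
theorem eventually_exp_mem_of_curve {G : Set A} (hmul : ∀ a ∈ G, ∀ b ∈ G, a * b ∈ G) {W : Set A}
    (hW : W ∈ 𝓝 (1 : A)) (hclosed : ∀ a ∈ W, a ∈ closure G → a ∈ G) {c : ℝ → A} {N : A}
    (hc0 : c 0 = 0) (hc : HasDerivAt c N 0) (hcG : ∀ᶠ t in 𝓝 0, 1 + c t ∈ G) :
    ∀ᶠ t : ℝ in 𝓝 0, NormedSpace.exp (t • N) ∈ G := by
  have hpow : ∀ a ∈ G, ∀ k : ℕ, 1 ≤ k → a ^ k ∈ G := by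
    intro a ha k hk
    induction k, hk using Nat.le_induction with
    | base => simpa using ha
    | succ k _ ih =>
      rw [pow_succ]
      exact hmul _ ih _ ha
  have hW' : ∀ᶠ t : ℝ in 𝓝 0, NormedSpace.exp (t • N) ∈ W := by
    have : ContinuousAt (fun t : ℝ => NormedSpace.exp (t • N)) 0 :=
      (hasDerivAt_exp_smul_const (𝕂 := ℝ) N (0 : ℝ)).continuousAt
    exact this.eventually (by simpa using hW)
  filter_upwards [hW'] with t ht
  refine hclosed _ ht (mem_closure_of_tendsto (tendsto_one_add_pow_exp_of_hasDerivAt hc0 hc t) ?_)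
  filter_upwards [(tendsto_div_natCast_zero t).eventually hcG, eventually_ge_atTop 1] with k hk h1
  exact hpow _ hk k h1

end OneParameter

/-! ### Curves in level sets and in the fibers of `H_q` -/

/-- A kernel vector of a surjective derivative is tangent to a curve in the level set. -/
theorem exists_curve_of_mem_ker {S J F : Type*} [NormedAddCommGroup S] [NormedSpace ℝ S]
    [CompleteSpace S] [NormedAddCommGroup J] [NormedSpace ℝ J] [NormedAddCommGroup F]
    [NormedSpace ℝ F] [FiniteDimensional ℝ F] {f : J → F} {f' : J →L[ℝ] F} {j : J}
    (hf : HasStrictFDerivAt f f' j) (L : S →L[ℝ] J) (hsurj : ∀ y, ∃ s, f' (L s) = y) {N : S}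
    (hN : f' (L N) = 0) :
    ∃ c : ℝ → S, c 0 = 0 ∧ HasDerivAt c N 0 ∧ ∀ᶠ t in 𝓝 0, f (j + L (c t)) = f j := by
  have hj : HasStrictFDerivAt (fun s : S => j + L s) L 0 := L.hasStrictFDerivAt.const_add j
  have h0 : j + L 0 = j := by simp
  have hΦ : HasStrictFDerivAt (fun s : S => f (j + L s)) (f'.comp L) 0 :=
    HasStrictFDerivAt.comp (f := fun s : S => j + L s) 0 (by rwa [h0]) hj
  have hr : (f'.comp L).range = ⊤ := LinearMap.range_eq_top.2 hsurj
  -- The curve is the image of the line `t • N'` under the implicit function, whose derivative at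
  -- `0` is the inclusion of the kernel.
  let N' : (f'.comp L).ker := ⟨N, hN⟩
  let g := hΦ.implicitFunction _ _ hr (f (j + L 0))
  have hline : HasDerivAt (fun t : ℝ => t • N') N' 0 :=
    ((hasDerivAt_id (0 : ℝ)).smul_const N').congr_deriv (one_smul ℝ N')
  have hN0 : (0 : ℝ) • N' = 0 := zero_smul ℝ N'
  have hg0 : g 0 = 0 := hΦ.implicitFunction_apply_image hr
  have hgd : HasDerivAt (fun t : ℝ => g (t • N')) N 0 := by
    have h1 : HasFDerivAt g (f'.comp L).ker.subtypeL ((0 : ℝ) • N') := by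
      rw [zero_smul]
      exact (hΦ.to_implicitFunction hr).hasFDerivAt
    exact h1.comp_hasDerivAt (0 : ℝ) hline
  refine ⟨fun t => g (t • N'), by simpa only [hN0] using hg0, hgd, ?_⟩
  have h1 := hΦ.map_implicitFunction_eq hr
  have h2 : Tendsto (fun t : ℝ => (f (j + L 0), t • N')) (𝓝 0) (𝓝 (f (j + L 0), 0)) := by
    refine tendsto_const_nhds.prodMk_nhds ?_
    have := hline.continuousAt.tendsto
    rwa [hN0] at this
  filter_upwards [h2.eventually h1] with t ht
  refine ht.trans ?_
  simp

namespace LiePseudoGroup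

variable {n m : ℕ} {E : Set (Coord n m)}
  {H : Set (OpenPartialHomeomorph (Coord n m) (Coord n m))}

lemma mapJet_id_mem_jets (hE : IsOpen E) (hH : IsPseudoGroup E H) (q : ℕ) {z : Coord n m}
    (hz : z ∈ E) : mapJet q id z ∈ jets H q :=
  ⟨OpenPartialHomeomorph.ofSet E hE, hH.id_mem E hE subset_rfl, z, hz, rfl⟩

lemma proj_idJetAdd {p q : ℕ} (hp : p < q) (z : Coord n m)
    (N : Coord n m [×q]→L[ℝ] Coord n m) : MapJet.proj hp.le (idJetAdd z N) = mapJet p id z := by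
  refine Prod.ext (by simp [MapJet.proj, mapJet, idJetAdd]) (funext fun k => ?_)
  have hne : Fin.castLE (Nat.succ_le_succ hp.le) k ≠ Fin.last q := by
    intro h
    have := congrArg Fin.val h
    have := k.2
    simp at *
    omega
  simp [MapJet.proj, mapJet, idJetAdd, Pi.single_eq_of_ne hne]

lemma IsDeterminingSystem.eq_zero {t k : ℕ} {W : Set (MapJet n m t)}
    {F : MapJet n m t → (Fin k → ℝ)} (h : IsDeterminingSystem E H t W F)
    (hH : IsPseudoGroup E H) {j : MapJet n m t} (hj : j ∈ W) (hjH : j ∈ jets H t) : F j = 0 := by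
  have hjD : j ∈ jets (diffeoPseudoGroup E) t := by
    obtain ⟨φ, hφ, z, hz, rfl⟩ := hjH
    exact ⟨φ, hH.subset hφ, z, hz, rfl⟩
  exact ((h.zero_set j hj hjD).1 hjH).2

/-- The lower order equations hold automatically, since the lower jets are identity jets; only `F =
0` remains to be imposed. -/
lemma IsDeterminingSystem.mem_fiber (hE : IsOpen E) (hH : IsPseudoGroup E H) {q k : ℕ}
    {W : Set (MapJet n m q)} {F : MapJet n m q → (Fin k → ℝ)}
    (h : IsDeterminingSystem E H q W F) {z : Coord n m} (hz : z ∈ E)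
    {N : Coord n m [×q]→L[ℝ] Coord n m} (hNW : idJetAdd z N ∈ W)
    (hN : N ∈ fiber (diffeoPseudoGroup E) q z) (hF : F (idJetAdd z N) = 0) : N ∈ fiber H q z := by
  refine (h.zero_set _ hNW hN).2 ⟨fun p hp => ?_, hF⟩
  rw [proj_idJetAdd hp]
  exact mapJet_id_mem_jets hE hH p hz

/-- The symmetric `q`-linear maps. -/
def symmetricMaps (V F : Type*) [NormedAddCommGroup V] [NormedSpace ℝ V] [NormedAddCommGroup F]
    [NormedSpace ℝ F] (q : ℕ) : Submodule ℝ (V [×q]→L[ℝ] F) where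
  carrier := {N | ∀ (σ : Equiv.Perm (Fin q)) (v : Fin q → V), N (fun i => v (σ i)) = N v}
  add_mem' := fun ha hb σ v => by simp [ha σ v, hb σ v]
  zero_mem' := fun σ v => by simp
  smul_mem' := fun c a ha σ v => by simp [ha σ v]

lemma isClosed_symmetricMaps (V F : Type*) [NormedAddCommGroup V] [NormedSpace ℝ V]
    [NormedAddCommGroup F] [NormedSpace ℝ F] (q : ℕ) :
    IsClosed (symmetricMaps V F q : Set (V [×q]→L[ℝ] F)) := by
  have : (symmetricMaps V F q : Set (V [×q]→L[ℝ] F)) =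
      ⋂ (σ : Equiv.Perm (Fin q)) (v : Fin q → V), {N | N (fun i => v (σ i)) = N v} := by
    ext N
    simp [symmetricMaps]
  rw [this]
  exact isClosed_iInter fun σ => isClosed_iInter fun v => isClosed_eq
    (ContinuousMultilinearMap.apply ℝ _ F _).continuous
    (ContinuousMultilinearMap.apply ℝ _ F _).continuous

/-- The fibers of `H_q` are locally closed near the identity. -/
theorem exists_nhds_closure_fiber_subset (hE : IsOpen E) (hH : IsLiePseudoGroup E H) {q : ℕ}
    (hq : 1 ≤ q) {z : Coord n m} (hz : z ∈ E) :
    ∃ W ∈ 𝓝 (0 : Coord n m [×q]→L[ℝ] Coord n m),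
      ∀ N ∈ W, N ∈ closure (fiber H q z) → N ∈ fiber H q z := by
  have hP := hH.isPseudoGroup
  obtain ⟨W, k, F, hjW, hF⟩ := hH.determining q _ (mapJet_id_mem_jets hE hP q hz)
  have hW : ∀ᶠ N in 𝓝 (0 : Coord n m [×q]→L[ℝ] Coord n m), idJetAdd z N ∈ W :=
    (continuous_idJetAdd z).continuousAt.eventually
      (hF.isOpen.mem_nhds (by rwa [idJetAdd_zero]))
  refine ⟨_, hW.and (eventually_mem_fiber_diffeo hE hq hz), ?_⟩
  rintro N ⟨hNW, hND⟩ hN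
  -- The equations characterize `H_q` only among jets of diffeomorphisms. A limit of fiber elements
  -- is symmetric, hence such a jet when small, and `F` vanishes there by continuity.
  have hsymm : N ∈ symmetricMaps (Coord n m) (Coord n m) q :=
    closure_minimal (fun M hM => fiber_symmetric hP hM) (isClosed_symmetricMaps _ _ q) hN
  refine hF.mem_fiber hE hP hz hNW (hND hsymm) ?_
  have hc : ContinuousAt (fun M => F (idJetAdd z M)) N :=
    ContinuousAt.comp (f := idJetAdd z) (hF.analytic _ hNW).continuousAt
      (continuous_idJetAdd z).continuousAt
  have hfreq : ∃ᶠ M in 𝓝 N, F (idJetAdd z M) ∈ ({0} : Set (Fin k → ℝ)) := by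
    refine ((mem_closure_iff_frequently.1 hN).and_eventually
      ((continuous_idJetAdd z).continuousAt.eventually (hF.isOpen.mem_nhds hNW))).mono ?_
    rintro M ⟨hM, hMW⟩
    exact hF.eq_zero hP hMW hM
  exact isClosed_singleton.mem_of_frequently_of_tendsto hfreq hc

/-- Infinitesimal solutions of the determining equations are tangent to curves in the fibers. -/
theorem exists_curve_mem_fiber (hE : IsOpen E) (hH : IsPseudoGroup E H) {q k : ℕ}
    (hq : 1 ≤ q) {z : Coord n m} (hz : z ∈ E) {W : Set (MapJet n m q)}
    {F : MapJet n m q → (Fin k → ℝ)} (hjW : mapJet q id z ∈ W)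
    (hF : IsDeterminingSystem E H q W F) {N : Coord n m [×q]→L[ℝ] Coord n m}
    (hN : N ∈ symmetricMaps (Coord n m) (Coord n m) q)
    (hNF : fderiv ℝ F (mapJet q id z) (0, Pi.single (Fin.last q) N) = 0) :
    ∃ c : ℝ → (Coord n m [×q]→L[ℝ] Coord n m), c 0 = 0 ∧ HasDerivAt c N 0 ∧
      ∀ᶠ t in 𝓝 0, c t ∈ fiber H q z := by
  have hjH := mapJet_id_mem_jets hE hH q hz
  let S := symmetricMaps (Coord n m) (Coord n m) q
  have : CompleteSpace S := (isClosed_symmetricMaps _ _ q).completeSpace_coe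
  -- Full rank is along symmetric directions, so the implicit function theorem is applied on that
  -- subspace. The curve then stays symmetric and consists, near `0`, of order `q` parts of jets of
  -- diffeomorphisms.
  let L : S →L[ℝ] MapJet n m q :=
    (ContinuousLinearMap.inr ℝ (Coord n m) _).comp
      ((ContinuousLinearMap.single ℝ
        (fun k : Fin (q + 1) => Coord n m [×(k : ℕ)]→L[ℝ] Coord n m) (Fin.last q)).comp S.subtypeL)
  obtain ⟨c, hc0, hcd, hcF⟩ := exists_curve_of_mem_ker (N := (⟨N, hN⟩ : S))
    (hF.analytic _ hjW).hasStrictFDerivAt L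
    (fun y => by
      obtain ⟨T, hT, hTc⟩ := hF.full_rank _ hjW hjH y
      exact ⟨⟨T, hT⟩, hTc⟩) hNF
  have hcd' : HasDerivAt (fun t : ℝ => (c t : Coord n m [×q]→L[ℝ] Coord n m)) N 0 := by
    have h : HasFDerivAt (fun s : S => (s : Coord n m [×q]→L[ℝ] Coord n m)) S.subtypeL (c 0) :=
      S.subtypeL.hasFDerivAt
    exact h.comp_hasDerivAt (0 : ℝ) hcd
  refine ⟨fun t => c t, by simp [hc0], hcd', ?_⟩
  have hct : Tendsto (fun t : ℝ => (c t : Coord n m [×q]→L[ℝ] Coord n m)) (𝓝 0) (𝓝 0) := by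
    simpa [hc0] using hcd'.continuousAt.tendsto
  have hW : ∀ᶠ M in 𝓝 (0 : Coord n m [×q]→L[ℝ] Coord n m), idJetAdd z M ∈ W :=
    (continuous_idJetAdd z).continuousAt.eventually
      (hF.isOpen.mem_nhds (by rwa [idJetAdd_zero]))
  filter_upwards [hct.eventually hW, hct.eventually (eventually_mem_fiber_diffeo hE hq hz), hcF]
    with t h1 h2 h3
  exact hF.mem_fiber hE hH hz h1 (h2 (c t).2) (h3.trans (hF.eq_zero hH hjW hjH))

end LiePseudoGroup

/-! ### Tangential arrays and the stabilizer of a section jet -/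

theorem iteratedFDeriv_comp_eq_zero {D E F : Type*} [NormedAddCommGroup D] [NormedSpace ℝ D]
    [NormedAddCommGroup E] [NormedSpace ℝ E] [NormedAddCommGroup F] [NormedSpace ℝ F]
    {g : E → F} {f : D → E} {x : D} {k : ℕ} (hg : ContDiffAt ℝ k g (f x))
    (hf : ContDiffAt ℝ k f x) (h : ∀ j ≤ k, iteratedFDeriv ℝ j g (f x) = 0) :
    iteratedFDeriv ℝ k (g ∘ f) x = 0 := by
  rw [iteratedFDeriv_comp hg hf le_rfl, FormalMultilinearSeries.taylorComp]
  refine Finset.sum_eq_zero fun c _ => ?_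
  refine DFunLike.ext _ _ fun v => ?_
  simp only [FormalMultilinearSeries.compAlongOrderedFinpartition_apply, ftaylorSeries]
  rw [h _ c.length_le]
  rfl

namespace LiePseudoGroup

variable {n m : ℕ}

/-- The second component of a vector relative to the graph of the linear map `A`. -/
noncomputable def graphDefect (A : (Fin n → ℝ) →L[ℝ] (Fin m → ℝ)) :
    Coord n m →L[ℝ] (Fin m → ℝ) :=
  ContinuousLinearMap.snd ℝ _ _ - A.comp (ContinuousLinearMap.fst ℝ _ _)

@[simp] lemma graphDefect_apply (A : (Fin n → ℝ) →L[ℝ] (Fin m → ℝ)) (w : Coord n m) :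
    graphDefect A w = w.2 - A w.1 := rfl

/-- The array `N` maps tangent vectors of the graph of `A` to tangent vectors. -/
def IsTangential {q : ℕ} (A : (Fin n → ℝ) →L[ℝ] (Fin m → ℝ))
    (N : Coord n m [×q]→L[ℝ] Coord n m) : Prop :=
  ∀ v : Fin q → Fin n → ℝ, graphDefect A (N fun i => (v i, A (v i))) = 0

/-- How far `φ` is from mapping the graph of `u` into the graph of `u'`. -/
def graphError (φ : Coord n m → Coord n m) (u u' : (Fin n → ℝ) → (Fin m → ℝ)) (y : Fin n → ℝ) :
    Fin m → ℝ :=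
  (φ (y, u y)).2 - u' (φ (y, u y)).1

lemma hasFDerivAt_graph {u : (Fin n → ℝ) → (Fin m → ℝ)} {x : Fin n → ℝ}
    (hu : ContDiffAt ℝ ∞ u x) : HasFDerivAt (fun y => (y, u y))
      ((ContinuousLinearMap.id ℝ _).prod (fderiv ℝ u x)) x :=
  (hasFDerivAt_id x).prodMk (hu.differentiableAt (by simp)).hasFDerivAt

/-- The leading derivative of the graph error of a map which agrees with the identity to lower
order. -/
theorem iteratedFDeriv_graphError {φ : Coord n m → Coord n m} {u u' : (Fin n → ℝ) → (Fin m → ℝ)}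
    {x : Fin n → ℝ} (hφ : ContDiffAt ℝ ∞ φ (x, u x)) (hu : ContDiffAt ℝ ∞ u x)
    (hu' : ContDiffAt ℝ ∞ u' x) {k : ℕ} (hk : 1 ≤ k)
    (hφk : ∀ j < k, iteratedFDeriv ℝ j φ (x, u x) = iteratedFDeriv ℝ j id (x, u x))
    (huu : ∀ j ≤ k, iteratedFDeriv ℝ j u x = iteratedFDeriv ℝ j u' x) (v : Fin k → Fin n → ℝ) :
    iteratedFDeriv ℝ k (graphError φ u u') x v =
      graphDefect (fderiv ℝ u x)
        (iteratedFDeriv ℝ k φ (x, u x) fun i => (v i, fderiv ℝ u x (v i))) := by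
  have hφz : φ (x, u x) = (x, u x) := iteratedFDeriv_zero_eq_iff.1 (hφk 0 hk)
  have hdu : fderiv ℝ u x = fderiv ℝ u' x := iteratedFDeriv_one_eq_iff.1 (huu 1 hk)
  set γ : (Fin n → ℝ) → Coord n m := fun y => (y, u y) with hγ
  have hγx : γ x = (x, u x) := rfl
  have hcγ : ContDiffAt ℝ ∞ γ x := contDiffAt_id.prodMk hu
  have hdγ := hasFDerivAt_graph hu
  have hcP : ContDiffAt ℝ ∞ (fun y => φ (γ y)) x := ContDiffAt.comp x (by exact hφ) hcγ
  have hcχ : ContDiffAt ℝ ∞ (fun y => (φ (γ y)).1) x := hcP.fst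
  have hcu' : ContDiffAt ℝ ∞ u' ((φ (γ x)).1) := by rwa [hγx, hφz]
  have hcuχ : ContDiffAt ℝ ∞ (fun y => u' (φ (γ y)).1) x :=
    ContDiffAt.comp (f := fun y => (φ (γ y)).1) x hcu' hcχ
  have hle : ∀ j : ℕ, ((j : ℕ) : WithTop ℕ∞) ≤ ∞ := fun j => by exact_mod_cast le_top
  have hdP : HasFDerivAt (fun y => φ (γ y)) ((fderiv ℝ φ (x, u x)).comp
      ((ContinuousLinearMap.id ℝ _).prod (fderiv ℝ u x))) x :=
    HasFDerivAt.comp (f := γ) x (hφ.differentiableAt (by simp)).hasFDerivAt hdγ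
  -- For `k = 1` the linear part of `φ` is itself the leading term and need not be the identity, so
  -- the chain rule is used directly.
  rcases eq_or_lt_of_le hk with rfl | hk
  · have hdu' : HasFDerivAt u' (fderiv ℝ u x) (φ (γ x)).1 := by
      rw [hγx, hφz, hdu]
      exact (hu'.differentiableAt (by simp)).hasFDerivAt
    have h := hdP.snd.sub (HasFDerivAt.comp (f := fun y => (φ (γ y)).1) x hdu' hdP.fst)
    rw [iteratedFDeriv_one_apply]
    have h' : fderiv ℝ (graphError φ u u') x = _ := h.fderiv
    rw [h', iteratedFDeriv_one_apply]
    rfl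
  · have hdφ : fderiv ℝ φ (x, u x) = ContinuousLinearMap.id ℝ _ :=
      fderiv_eq_id_of_iteratedFDeriv (hφk 1 hk)
    rw [hdφ, ContinuousLinearMap.id_comp] at hdP
    have hfst : ∀ {f : (Fin n → ℝ) → Coord n m}, ContDiffAt ℝ ∞ f x → ∀ (j : ℕ) w,
        iteratedFDeriv ℝ j (fun y => (f y).1) x w = (iteratedFDeriv ℝ j f x w).1 :=
      fun hf j w => DFunLike.congr_fun ((ContinuousLinearMap.fst ℝ (Fin n → ℝ)
        (Fin m → ℝ)).iteratedFDeriv_comp_left hf (hle j)) w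
    have hsnd : ∀ {f : (Fin n → ℝ) → Coord n m}, ContDiffAt ℝ ∞ f x → ∀ (j : ℕ) w,
        iteratedFDeriv ℝ j (fun y => (f y).2) x w = (iteratedFDeriv ℝ j f x w).2 :=
      fun hf j w => DFunLike.congr_fun ((ContinuousLinearMap.snd ℝ (Fin n → ℝ)
        (Fin m → ℝ)).iteratedFDeriv_comp_left hf (hle j)) w
    -- Here the outer map `φ` has vanishing intermediate derivatives, while those of `γ` are
    -- arbitrary.
    have hP : ∀ j, 2 ≤ j → j ≤ k → ∀ w : Fin j → Fin n → ℝ,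
        iteratedFDeriv ℝ j (fun y => φ (γ y)) x w =
          iteratedFDeriv ℝ j φ (x, u x) (fun i => (w i, fderiv ℝ u x (w i))) +
            iteratedFDeriv ℝ j γ x w := by
      intro j hj hjk w
      rw [iteratedFDeriv_comp_of_intermediate_eq_zero hj (ContDiffAt.of_le (by exact hφ) (hle j))
        (hcγ.of_le (hle j)) (Or.inl fun i hi hij => ?_), hγx, hdφ, hdγ.fderiv]
      · rfl
      · rw [hγx, hφk i (by omega), iteratedFDeriv_id_of_two_le hi]
    have hχ : ∀ j, 2 ≤ j → j ≤ k → ∀ w : Fin j → Fin n → ℝ,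
        iteratedFDeriv ℝ j (fun y => (φ (γ y)).1) x w =
          (iteratedFDeriv ℝ j φ (x, u x) (fun i => (w i, fderiv ℝ u x (w i)))).1 := by
      intro j hj hjk w
      have h0 : (iteratedFDeriv ℝ j γ x w).1 = 0 := by
        rw [← hfst hcγ]
        exact DFunLike.congr_fun (iteratedFDeriv_id_of_two_le hj x) w
      rw [hfst hcP, hP j hj hjk, Prod.fst_add, h0, add_zero]
    have hdχ : fderiv ℝ (fun y => (φ (γ y)).1) x = ContinuousLinearMap.id ℝ _ := hdP.fst.fderiv
    -- Now the inner map has vanishing intermediate derivatives, because the base component of `γ`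
    -- is the identity. The term `iteratedFDeriv ℝ k u x v` cancels against the one coming from `γ`.
    have huχ : iteratedFDeriv ℝ k (fun y => u' (φ (γ y)).1) x v = iteratedFDeriv ℝ k u x v +
        fderiv ℝ u x
          (iteratedFDeriv ℝ k φ (x, u x) (fun i => (v i, fderiv ℝ u x (v i)))).1 := by
      rw [iteratedFDeriv_comp_of_intermediate_eq_zero (f := fun y => (φ (γ y)).1) hk
        (hcu'.of_le (hle k)) (hcχ.of_le (hle k)) (Or.inr fun j hj hjk => ?_), hdχ, hχ k hk le_rfl,
        hγx, hφz, ← huu k le_rfl, hdu]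
      · rfl
      · refine DFunLike.ext _ _ fun w => ?_
        rw [hχ j hj hjk.le, hφk j hjk, iteratedFDeriv_id_of_two_le hj]
        rfl
    have hsub : iteratedFDeriv ℝ k (graphError φ u u') x v =
        iteratedFDeriv ℝ k (fun y => (φ (γ y)).2) x v -
          iteratedFDeriv ℝ k (fun y => u' (φ (γ y)).1) x v :=
      DFunLike.congr_fun (iteratedFDeriv_sub_apply (hcP.snd.of_le (hle k))
        (hcuχ.of_le (hle k))) v
    have hγ2 : (iteratedFDeriv ℝ k γ x v).2 = iteratedFDeriv ℝ k u x v := (hsnd hcγ k v).symm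
    rw [hsub, huχ, hsnd hcP, hP k hk le_rfl, Prod.snd_add, hγ2, graphDefect_apply]
    abel

variable {E : Set (Coord n m)} {H : Set (OpenPartialHomeomorph (Coord n m) (Coord n m))}

lemma isUnit_fderiv_of_mem_diffeo {φ : OpenPartialHomeomorph (Coord n m) (Coord n m)}
    (hφ : φ ∈ diffeoPseudoGroup E) {z : Coord n m} (hz : z ∈ φ.source) :
    IsUnit (fderiv ℝ φ z) := by
  have h1 : DifferentiableAt ℝ φ z :=
    (contDiffAt_of_mem_diffeo hφ hz).differentiableAt (by simp)
  have h2 : DifferentiableAt ℝ φ.symm (φ z) :=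
    (hφ.2.2.2.contDiffAt (φ.open_target.mem_nhds (φ.map_source hz))).differentiableAt (by simp)
  have hz' : φ.symm (φ z) = z := φ.left_inv hz
  refine ⟨⟨fderiv ℝ φ z, fderiv ℝ φ.symm (φ z), ?_, ?_⟩, rfl⟩
  · have h3 : φ ∘ φ.symm =ᶠ[𝓝 (φ z)] id := φ.eventually_right_inverse (φ.map_source hz)
    have h4 := fderiv_comp (φ z) (g := φ) (f := φ.symm) (by rwa [hz']) h2
    rw [h3.fderiv_eq, fderiv_id, hz'] at h4
    exact h4.symm
  · have h3 : φ.symm ∘ φ =ᶠ[𝓝 z] id := φ.eventually_left_inverse hz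
    have h4 := fderiv_comp z (g := φ.symm) (f := φ) h2 h1
    rw [h3.fderiv_eq, fderiv_id] at h4
    exact h4.symm

lemma graphError_zero_of_id {φ : Coord n m → Coord n m} {u : (Fin n → ℝ) → (Fin m → ℝ)}
    {x : Fin n → ℝ} (hφ : φ (x, u x) = (x, u x)) : graphError φ u u x = 0 := by
  simp [graphError, hφ]

/-- A jet over the identity jet of lower order whose leading part is tangential fixes the jet of
the section. -/
theorem prolongedAction_self_of_isTangential (hE : IsOpen E)
    {φ : OpenPartialHomeomorph (Coord n m) (Coord n m)} (hφ : φ ∈ diffeoPseudoGroup E)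
    {u : (Fin n → ℝ) → (Fin m → ℝ)} {x : Fin n → ℝ} (hz : (x, u x) ∈ φ.source)
    (hu : ∀ᶠ y in 𝓝 x, ContDiffAt ℝ ∞ u y) {q : ℕ} (hq : 1 ≤ q)
    (hφk : ∀ j < q, iteratedFDeriv ℝ j φ (x, u x) = iteratedFDeriv ℝ j id (x, u x))
    (htan : IsTangential (fderiv ℝ u x) (iteratedFDeriv ℝ q φ (x, u x))) :
    ProlongedAction E q (mapJet q φ (x, u x)) (secJet q u x) (secJet q u x) := by
  have hux := hu.self_of_nhds
  have hφz : φ (x, u x) = (x, u x) := iteratedFDeriv_zero_eq_iff.1 (hφk 0 hq)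
  have hφx := contDiffAt_of_mem_diffeo hφ hz
  have hcγ : ContinuousAt (fun y => (y, u y)) x := continuousAt_id.prodMk hux.continuousAt
  have hcχ : ContinuousAt (fun y => (φ (y, u y)).1) x :=
    (ContinuousAt.comp (f := fun y => (y, u y)) (by exact hφx.continuousAt) hcγ).fst
  have herr : ∀ᶠ y in 𝓝 x, ContDiffAt ℝ ∞ (graphError φ u u) y := by
    have h1 : ∀ᶠ y in 𝓝 x, (y, u y) ∈ φ.source :=
      hcγ.eventually (φ.open_source.mem_nhds hz)
    have h2 : ∀ᶠ y in 𝓝 x, ContDiffAt ℝ ∞ u (φ (y, u y)).1 :=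
      hcχ.eventually (by simpa [hφz] using hu)
    filter_upwards [hu, h1, h2] with y hy1 hy2 hy3
    have hP : ContDiffAt ℝ ∞ (fun y => φ (y, u y)) y :=
      ContDiffAt.comp (f := fun y => (y, u y)) y (contDiffAt_of_mem_diffeo hφ hy2)
        (contDiffAt_id.prodMk hy1)
    exact hP.snd.sub (ContDiffAt.comp (f := fun y => (φ (y, u y)).1) y hy3 hP.fst)
  have hD0 : ∀ k ≤ q, iteratedFDeriv ℝ k (graphError φ u u) x = 0 := by
    intro k hk
    refine DFunLike.ext _ _ fun v => ?_
    rcases Nat.eq_zero_or_pos k with rfl | hk0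
    · rw [iteratedFDeriv_zero_apply, graphError_zero_of_id hφz]
      rfl
    · rw [iteratedFDeriv_graphError hφx hux hux hk0 (fun j hj => hφk j (by omega))
        fun _ _ => rfl]
      rcases eq_or_lt_of_le hk with rfl | hk
      · exact htan v
      · rw [hφk k hk]
        rcases eq_or_lt_of_le (Nat.succ_le_of_lt hk0) with h1 | h1
        · subst h1
          simp
        · rw [iteratedFDeriv_id_of_two_le h1]
          simp
  let ι : (Fin m → ℝ) →L[ℝ] Coord n m := ContinuousLinearMap.inr ℝ _ _
  let ρ : Coord n m →L[ℝ] (Fin n → ℝ) := ContinuousLinearMap.fst ℝ _ _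
  -- The action requires a diffeomorphism preserving the graph exactly, not just to order `q`.
  -- Subtracting the graph error vertically achieves this, and leaves the `q`-jet unchanged because
  -- the error vanishes to order `q`. The corrected map need not lie in `H`; only its jet does when
  -- that of `φ` does.
  let f : Coord n m → Coord n m := fun w => φ w - ι (graphError φ u u (ρ w))
  have hcorr : ∀ᶠ w in 𝓝 (x, u x), ContDiffAt ℝ ∞ (fun w => ι (graphError φ u u (ρ w))) w := by
    have : ∀ᶠ w in 𝓝 (x, u x), ContDiffAt ℝ ∞ (graphError φ u u) (ρ w) :=
      (ρ.continuous.continuousAt (x := (x, u x))).eventually herr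
    filter_upwards [this] with w hw
    exact ι.contDiff.contDiffAt.comp w (hw.comp w ρ.contDiff.contDiffAt)
  have hfs : ∀ᶠ w in 𝓝 (x, u x), ContDiffAt ℝ ∞ f w := by
    filter_upwards [hcorr, φ.open_source.mem_nhds hz] with w h1 h2
    exact (contDiffAt_of_mem_diffeo hφ h2).sub h1
  have hle : ∀ j : ℕ, ((j : ℕ) : WithTop ℕ∞) ≤ ∞ := fun j => by exact_mod_cast le_top
  have hfk : ∀ k ≤ q, iteratedFDeriv ℝ k f (x, u x) = iteratedFDeriv ℝ k φ (x, u x) := by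
    intro k hk
    have h1 : iteratedFDeriv ℝ k (fun w => ι (graphError φ u u (ρ w))) (x, u x) = 0 := by
      have h2 : ContDiffAt ℝ k (graphError φ u u ∘ ρ) (x, u x) :=
        (ContDiffAt.comp (x, u x) (herr.self_of_nhds) ρ.contDiff.contDiffAt).of_le (hle k)
      change iteratedFDeriv ℝ k (ι ∘ (graphError φ u u ∘ ρ)) (x, u x) = 0
      rw [ι.iteratedFDeriv_comp_left h2 le_rfl]
      have h3 : iteratedFDeriv ℝ k (graphError φ u u ∘ ρ) (x, u x) = 0 := by
        exact iteratedFDeriv_comp_eq_zero (herr.self_of_nhds.of_le (hle k))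
          (ρ.contDiff.contDiffAt) fun j hj => hD0 j (hj.trans hk)
      rw [h3]
      refine DFunLike.ext _ _ fun v => ?_
      simp
    have h2 := fun_iteratedFDeriv_sub_apply (hφx.of_le (hle k))
      (hcorr.self_of_nhds.of_le (hle k))
    rw [h1, sub_zero] at h2
    exact h2
  have hfz : f (x, u x) = (x, u x) := by
    rw [iteratedFDeriv_zero_eq_iff.1 (hfk 0 (by omega)), hφz]
  have hunit : IsUnit (fderiv ℝ f (x, u x)) := by
    rw [iteratedFDeriv_one_eq_iff.1 (hfk 1 hq)]
    exact isUnit_fderiv_of_mem_diffeo hφ hz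
  have hzE : (x, u x) ∈ E := hφ.1 hz
  obtain ⟨ψ, hψ, hzψ, hψf⟩ := exists_diffeo_of_contDiffAt hE hfs hunit hzE (by rwa [hfz])
  refine ⟨ψ, hψ, u, u, x, hzψ, hu, ?_, ?_, ?_, rfl, ?_⟩
  · rwa [hψf, hfz]
  · refine Eventually.of_forall fun y => ?_
    rw [hψf]
    simp [f, ι, ρ, graphError]
  · rw [hψf]
    exact Prod.ext rfl (funext fun k => (hfk k (Nat.lt_succ_iff.1 k.2)).symm)
  · rw [hψf, hfz]

end LiePseudoGroup

/-! ### From freeness to infinitesimal freeness -/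

namespace LiePseudoGroup

variable {n m : ℕ} {E : Set (Coord n m)}
  {H : Set (OpenPartialHomeomorph (Coord n m) (Coord n m))}

lemma isTangential_id {q : ℕ} (hq : 1 ≤ q) (A : (Fin n → ℝ) →L[ℝ] (Fin m → ℝ)) (z : Coord n m) :
    IsTangential A (iteratedFDeriv ℝ q id z) := by
  intro v
  rcases eq_or_lt_of_le hq with rfl | hq
  · simp
  · rw [iteratedFDeriv_id_of_two_le hq]
    simp

/-- If `H_q` acts freely on a set of jets containing that of `u` at `x`, the fiber of `H_q` over
the identity jet of order `q - 1` has no nonzero tangential element. -/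
theorem eq_zero_of_mem_fiber_of_isTangential (hE : IsOpen E) (hH : IsPseudoGroup E H) {q : ℕ}
    (hq : 1 ≤ q) {V : Set (SecJet n m q)} (hfree : ActsFreelyOn E H q V)
    {u : (Fin n → ℝ) → (Fin m → ℝ)} {x : Fin n → ℝ} (hu : ∀ᶠ y in 𝓝 x, ContDiffAt ℝ ∞ u y)
    (hV : secJet q u x ∈ V) {N : Coord n m [×q]→L[ℝ] Coord n m} (hN : N ∈ fiber H q (x, u x))
    (htan : IsTangential (fderiv ℝ u x) N) : N = 0 := by
  obtain ⟨φ, hφ, hz, h1, h2⟩ := mem_fiber_iff.1 hN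
  have hid : mapJet q φ (x, u x) = idJetAdd (x, u x) N := eq_idJetAdd_iff.2 ⟨rfl, h1, h2⟩
  have hact := prolongedAction_self_of_isTangential hE (hH.subset hφ) hz hu hq h1 (by
    intro v
    rw [h2, add_apply, map_add, htan v, isTangential_id hq _ _ v, add_zero])
  rw [hid] at hact
  have h := hfree _ hV _ hN hact
  rw [show (idJetAdd (x, u x) N).1 = (x, u x) by simp [idJetAdd, mapJet]] at h
  exact idJetAdd_eq_mapJet_id_iff.1 h

/-- All powers of `B` preserve the graph of `A`, so the continuous map `graphDefect A` kills the
exponential series term by term. -/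
lemma graphDefect_exp_smul_apply {A : (Fin n → ℝ) →L[ℝ] (Fin m → ℝ)}
    {B : Coord n m →L[ℝ] Coord n m} (hB : ∀ w, graphDefect A w = 0 → graphDefect A (B w) = 0)
    {w : Coord n m} (hw : graphDefect A w = 0) :
    graphDefect A (NormedSpace.exp B w) = 0 := by
  have hpow : ∀ k : ℕ, graphDefect A ((B ^ k) w) = 0 := by
    intro k
    induction k with
    | zero => simpa using hw
    | succ k ih =>
      rw [pow_succ']
      exact hB _ ih
  have h1 := NormedSpace.exp_series_hasSum_exp' (𝕂 := ℝ) B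
  have h2 := h1.mapL ((graphDefect A).comp (ContinuousLinearMap.apply ℝ (Coord n m) w))
  refine h2.unique ?_
  convert hasSum_zero with k
  simp only [ContinuousLinearMap.comp_apply, ContinuousLinearMap.apply_apply, map_smul, hpow,
    smul_zero]

/-- Freeness of the action of `H_q` implies infinitesimal freeness: the determining equations have
no nonzero tangential infinitesimal solution of order `q`. -/
theorem eq_zero_of_mem_ker_of_isTangential (hE : IsOpen E) (hH : IsLiePseudoGroup E H) {q k : ℕ}
    (hq : 1 ≤ q) {V : Set (SecJet n m q)} (hfree : ActsFreelyOn E H q V)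
    {u : (Fin n → ℝ) → (Fin m → ℝ)} {x : Fin n → ℝ} (hu : ∀ᶠ y in 𝓝 x, ContDiffAt ℝ ∞ u y)
    (hV : secJet q u x ∈ V) (hz : (x, u x) ∈ E) {W : Set (MapJet n m q)}
    {F : MapJet n m q → (Fin k → ℝ)} (hjW : mapJet q id (x, u x) ∈ W)
    (hF : IsDeterminingSystem E H q W F) {N : Coord n m [×q]→L[ℝ] Coord n m}
    (hN : N ∈ symmetricMaps (Coord n m) (Coord n m) q)
    (hNF : fderiv ℝ F (mapJet q id (x, u x)) (0, Pi.single (Fin.last q) N) = 0)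
    (htan : IsTangential (fderiv ℝ u x) N) : N = 0 := by
  have hP := hH.isPseudoGroup
  obtain ⟨c, hc0, hcd, hcF⟩ := exists_curve_mem_fiber hE hP hq hz hjW hF hN hNF
  obtain ⟨O, hO, hclosed⟩ := exists_nhds_closure_fiber_subset hE hH hq hz
  have hfix := fun M hM ht => eq_zero_of_mem_fiber_of_isTangential (N := M) hE hP hq hfree hu hV hM ht
  rcases eq_or_lt_of_le hq with rfl | hq2
  -- The exponential limit uses `‖1‖ = 1` in the endomorphism algebra, which fails on the zero
  -- space.
  · rcases subsingleton_or_nontrivial (Coord n m) with hs | hs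
    · exact DFunLike.ext _ _ fun v => Subsingleton.elim _ _
    let curry := continuousMultilinearCurryFin1 ℝ (Coord n m) (Coord n m)
    let B := curry N
    have hcd' : HasDerivAt (fun t => curry (c t)) B 0 := by
      have h : HasFDerivAt curry (curry.toContinuousLinearEquiv : _ →L[ℝ] _) (c 0) :=
        curry.toContinuousLinearEquiv.hasFDerivAt
      exact h.comp_hasDerivAt (0 : ℝ) hcd
    have hctoOne : Continuous fun A : Coord n m →L[ℝ] Coord n m => toOrderOne (A - 1) :=
      curry.symm.continuous.comp (continuous_id.sub continuous_const)
    have hexp := eventually_exp_mem_of_curve (G := {A | toOrderOne (A - 1) ∈ fiber H 1 (x, u x)})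
      (W := {A | toOrderOne (A - 1) ∈ O}) (fun a ha b hb => mul_sub_one_mem_fiber hP ha hb)
      (hctoOne.continuousAt.preimage_mem_nhds (by simpa using hO))
      (fun a ha hcl => hclosed _ ha (map_mem_closure (f := fun A => toOrderOne (A - 1)) hctoOne hcl fun _ h => h))
      (c := fun t => curry (c t)) (by simp [hc0]) hcd'
      (by
        filter_upwards [hcF] with t ht
        simpa [toOrderOne, curry] using ht)
    have hBtan : ∀ w, graphDefect (fderiv ℝ u x) w = 0 → graphDefect (fderiv ℝ u x) (B w) = 0 := by
      intro w hw
      have h1 : w = (w.1, fderiv ℝ u x w.1) := Prod.ext rfl (sub_eq_zero.1 hw)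
      have h2 := htan fun _ => w.1
      rw [← h1] at h2
      convert h2 using 2
      simp only [B, curry, continuousMultilinearCurryFin1_apply]
      congr 1
    -- `exp (t • B)` preserves the graph subspace, so `exp (t • B) - 1` is a tangential fiber
    -- element and vanishes by freeness. Differentiating at `t = 0` then gives `B = 0`.
    have hone : ∀ᶠ t : ℝ in 𝓝 0, NormedSpace.exp (t • B) = 1 := by
      filter_upwards [hexp] with t ht
      have h := hfix _ ht (by
        intro v
        have hv : graphDefect (fderiv ℝ u x) (v 0, fderiv ℝ u x (v 0)) = 0 := by simp
        have h3 := graphDefect_exp_smul_apply (B := t • B) (fun w hw => by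
          rw [smul_apply, map_smul, hBtan w hw, smul_zero]) hv
        change graphDefect _ ((NormedSpace.exp (t • B) - 1) (v 0, fderiv ℝ u x (v 0))) = 0
        rw [sub_apply, map_sub, h3, zero_sub, neg_eq_zero]
        exact hv)
      exact sub_eq_zero.1 ((LinearIsometryEquiv.map_eq_zero_iff _).1 h)
    have hB0 : B = 0 := by
      have h1 : HasDerivAt (fun t : ℝ => NormedSpace.exp (t • B)) B 0 := by
        simpa using hasDerivAt_exp_smul_const (𝕂 := ℝ) B (0 : ℝ)
      have h2 : HasDerivAt (fun t : ℝ => NormedSpace.exp (t • B)) 0 0 :=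
        (hasDerivAt_const (0 : ℝ) (1 : Coord n m →L[ℝ] Coord n m)).congr_of_eventuallyEq hone
      exact h1.unique h2
    exact (LinearIsometryEquiv.map_eq_zero_iff curry).1 hB0
  · have hline := eventually_smul_mem_of_curve (fun a ha b hb => add_mem_fiber hP hq2 ha hb) hO
      hclosed hc0 hcd hcF
    -- One nonzero `t` suffices: freeness gives `t • N = 0`.
    obtain ⟨t, ht, ht0⟩ := ((hline.filter_mono nhdsWithin_le_nhds).and
      (self_mem_nhdsWithin (a := (0 : ℝ)) (s := {0}ᶜ))).exists
    have h := hfix _ ht fun v => by rw [smul_apply, map_smul, htan v, smul_zero]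
    exact (smul_eq_zero.1 h).resolve_left ht0

/-- The contraction of the leading part of an element of `H_{q+1}` over the identity `q`-jet
satisfies the linearized determining equations of order `q`. -/
theorem fderiv_apply_single_fderiv_iteratedFDeriv (hE : IsOpen E) (hH : IsPseudoGroup E H)
    {q k : ℕ} (hq : 1 ≤ q) {ψ : OpenPartialHomeomorph (Coord n m) (Coord n m)} (hψ : ψ ∈ H)
    {z : Coord n m} (hz : z ∈ ψ.source)
    (hψk : ∀ j ≤ q, iteratedFDeriv ℝ j ψ z = iteratedFDeriv ℝ j id z) {W : Set (MapJet n m q)}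
    {F : MapJet n m q → (Fin k → ℝ)} (hjW : mapJet q id z ∈ W)
    (hF : IsDeterminingSystem E H q W F) (v : Coord n m) :
    fderiv ℝ F (mapJet q id z)
      (0, Pi.single (Fin.last q) (fderiv ℝ (iteratedFDeriv ℝ q ψ) z v)) = 0 := by
  have hD : HasFDerivAt F (fderiv ℝ F (mapJet q id z)) (mapJet q id z) :=
    (hF.analytic _ hjW).differentiableAt.hasFDerivAt
  have hψid : mapJet q ψ z = mapJet q id z :=
    Prod.ext rfl (funext fun j => hψk j (Nat.lt_succ_iff.1 j.2))
  -- `F` vanishes along the section `w ↦ mapJet q f w` near `z`, so the chain rule annihilates its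
  -- derivative in the direction `v`.
  have key : ∀ f : Coord n m → Coord n m, ContDiffAt ℝ ∞ f z → mapJet q f z = mapJet q id z →
      (∀ᶠ w in 𝓝 z, mapJet q f w ∈ jets H q) →
      fderiv ℝ F (mapJet q id z) (v, fun j : Fin (q + 1) =>
        fderiv ℝ (iteratedFDeriv ℝ (j : ℕ) f) z v) = 0 := by
    intro f hf hfz hfH
    have hpi : HasFDerivAt (mapJet q f) ((ContinuousLinearMap.id ℝ (Coord n m)).prod
        (ContinuousLinearMap.pi fun j : Fin (q + 1) => fderiv ℝ (iteratedFDeriv ℝ (j : ℕ) f) z))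
        z := by
      refine (hasFDerivAt_id z).prodMk (hasFDerivAt_pi.2 fun j => ?_)
      exact (ContDiffAt.iteratedFDeriv_right (m := 1) hf
        (by exact_mod_cast le_top)).differentiableAt (by norm_num) |>.hasFDerivAt
    have hcomp := HasFDerivAt.comp (f := mapJet q f) z (by rw [hfz]; exact hD) hpi
    have hzero : F ∘ mapJet q f =ᶠ[𝓝 z] fun _ => 0 := by
      filter_upwards [hfH, hpi.continuousAt.eventually
        (hF.isOpen.mem_nhds (by rwa [hfz]))] with w h1 h2
      exact hF.eq_zero hH h2 h1
    have := hcomp.unique ((hasFDerivAt_const (0 : Fin k → ℝ) z).congr_of_eventuallyEq hzero)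
    exact DFunLike.congr_fun this v
  have hzE : z ∈ E := (hH.subset hψ).1 hz
  have h1 := key ψ (contDiffAt_of_mem_diffeo (hH.subset hψ) hz) hψid (by
    filter_upwards [ψ.open_source.mem_nhds hz] with w hw
    exact ⟨ψ, hψ, w, hw, rfl⟩)
  have h2 := key id contDiffAt_id rfl (by
    filter_upwards [hE.mem_nhds hzE] with w hw
    exact mapJet_id_mem_jets hE hH q hw)
  -- Subtracting the relation for the identity cancels the source component and all orders below
  -- `q`. At order `q` the identity contributes zero, since `q + 1 ≥ 2`.
  rw [← sub_eq_zero.2 (h1.trans h2.symm), ← map_sub]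
  congr 1
  refine Prod.ext (by simp) (funext fun j => ?_)
  rcases eq_or_ne j (Fin.last q) with rfl | hj
  · have h3 : fderiv ℝ (iteratedFDeriv ℝ q (id : Coord n m → Coord n m)) z v = 0 :=
      DFunLike.ext _ _ fun w => by
        have := DFunLike.congr_fun
          (iteratedFDeriv_id_of_two_le (show 2 ≤ q + 1 by omega) z) (Fin.cons v w)
        simpa [iteratedFDeriv_succ_apply_left] using this
    simp [h3]
  · have hj' : (j : ℕ) + 1 ≤ q := by
      have := j.2
      have : (j : ℕ) ≠ q := fun h => hj (Fin.ext h)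
      omega
    have h3 : fderiv ℝ (iteratedFDeriv ℝ (j : ℕ) ψ) z v =
        fderiv ℝ (iteratedFDeriv ℝ (j : ℕ) id) z v :=
      DFunLike.ext _ _ fun w => by
        have := DFunLike.congr_fun (hψk _ hj') (Fin.cons v w)
        simpa only [iteratedFDeriv_succ_apply_left, Fin.cons_zero, Fin.tail_cons] using this
    simp [Pi.single_eq_of_ne hj, h3]

end LiePseudoGroup

/-! ### Vanishing of the leading part and persistence of freeness -/

namespace LiePseudoGroup

variable {n m : ℕ} {E : Set (Coord n m)}
  {H : Set (OpenPartialHomeomorph (Coord n m) (Coord n m))}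

/-- This is the symmetry of the derivative of order `q + 1` under permutations fixing the first
slot. -/
lemma fderiv_iteratedFDeriv_apply_mem_symmetricMaps {q : ℕ} {f : Coord n m → Coord n m}
    {z : Coord n m} (hf : ContDiffAt ℝ ∞ f z) (v : Coord n m) :
    fderiv ℝ (iteratedFDeriv ℝ q f) z v ∈ symmetricMaps (Coord n m) (Coord n m) q := by
  intro σ w
  have h := iteratedFDeriv_comp_perm_of_contDiffAt (n := q + 1)
    (hf.of_le (by exact_mod_cast le_top)) (Equiv.Perm.decomposeFin.symm (0, σ)) (Fin.cons v w)
  have hcons : (fun i => (Fin.cons v w : Fin (q + 1) → Coord n m)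
      (Equiv.Perm.decomposeFin.symm (0, σ) i)) = Fin.cons v fun i => w (σ i) := by
    funext i
    refine Fin.cases ?_ (fun i => ?_) i <;> simp
  rw [hcons] at h
  simpa only [iteratedFDeriv_succ_apply_left, Fin.cons_zero, Fin.tail_cons] using h

/-- If `H_q` acts freely at the `q`-jet of `u`, the leading part of an element of `H_{q+1}` over the
identity `q`-jet vanishes as soon as it is tangential. -/
theorem iteratedFDeriv_succ_eq_zero_of_isTangential (hE : IsOpen E) (hH : IsLiePseudoGroup E H)
    {q : ℕ} (hq : 1 ≤ q) {V : Set (SecJet n m q)} (hfree : ActsFreelyOn E H q V)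
    {u : (Fin n → ℝ) → (Fin m → ℝ)} {x : Fin n → ℝ} (hu : ∀ᶠ y in 𝓝 x, ContDiffAt ℝ ∞ u y)
    (hV : secJet q u x ∈ V) {ψ : OpenPartialHomeomorph (Coord n m) (Coord n m)} (hψ : ψ ∈ H)
    (hz : (x, u x) ∈ ψ.source)
    (hψk : ∀ j ≤ q, iteratedFDeriv ℝ j ψ (x, u x) = iteratedFDeriv ℝ j id (x, u x))
    (htan : IsTangential (fderiv ℝ u x) (iteratedFDeriv ℝ (q + 1) ψ (x, u x))) :
    iteratedFDeriv ℝ (q + 1) ψ (x, u x) = 0 := by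
  have hP := hH.isPseudoGroup
  have hzE : (x, u x) ∈ E := (hP.subset hψ).1 hz
  have hcψ := contDiffAt_of_mem_diffeo (hP.subset hψ) hz
  obtain ⟨W, k, F, hjW, hF⟩ := hH.determining q _ (mapJet_id_mem_jets hE hP q hzE)
  have hzero : ∀ v, IsTangential (fderiv ℝ u x) (fderiv ℝ (iteratedFDeriv ℝ q ψ) (x, u x) v) →
      fderiv ℝ (iteratedFDeriv ℝ q ψ) (x, u x) v = 0 := fun v hv =>
    eq_zero_of_mem_ker_of_isTangential hE hH hq hfree hu hV hzE hjW hF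
      (fderiv_iteratedFDeriv_apply_mem_symmetricMaps hcψ v)
      (fderiv_apply_single_fderiv_iteratedFDeriv hE hP hq hψ hz hψk hjW hF v) hv
  have hT : ∀ a : Fin n → ℝ,
      fderiv ℝ (iteratedFDeriv ℝ q ψ) (x, u x) (a, fderiv ℝ u x a) = 0 := by
    refine fun a => hzero _ fun b => ?_
    have h := htan (Fin.cons a b)
    rw [iteratedFDeriv_succ_apply_left] at h
    exact h
  -- Swapping the first two arguments puts a graph vector in the contracted slot, where `hT`
  -- applies; this needs `q ≥ 1`. The contraction by `v` thus vanishes on graph vectors, and `hzero`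
  -- gives the rest.
  have hall : ∀ v, fderiv ℝ (iteratedFDeriv ℝ q ψ) (x, u x) v = 0 := by
    refine fun v => hzero v fun b => ?_
    obtain ⟨q, rfl⟩ := Nat.exists_eq_add_of_le' hq
    have hle : ∀ j : ℕ, (j : WithTop ℕ∞) ≤ ∞ := fun j => by exact_mod_cast le_top
    let b' : Fin (q + 1) → Coord n m := fun i => (b i, fderiv ℝ u x (b i))
    have h := iteratedFDeriv_comp_perm_of_contDiffAt (n := q + 2) (f := ψ) (x := (x, u x))
      (hcψ.of_le (hle _)) (Equiv.swap 0 1) (Fin.cons v b')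
    rw [iteratedFDeriv_succ_apply_left, iteratedFDeriv_succ_apply_left] at h
    rw [Equiv.swap_apply_left, Fin.cons_zero, Fin.tail_cons,
      show (Fin.cons v b' : Fin (q + 2) → Coord n m) 1 = b' 0 from rfl, hT (b 0)] at h
    change graphDefect _ (fderiv ℝ (iteratedFDeriv ℝ (q + 1) ψ) (x, u x) v b') = 0
    rw [← h]
    simp
  refine DFunLike.ext _ _ fun w => ?_
  rw [iteratedFDeriv_succ_apply_left, hall]
  rfl

end LiePseudoGroup

theorem mainTheorem5 (n m : ℕ) (X : Set (Fin n → ℝ)) (U : Set (Fin m → ℝ))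
    (hX : IsOpen X) (hU : IsOpen U)
    (H : Set (OpenPartialHomeomorph (LiePseudoGroup.Coord n m) (LiePseudoGroup.Coord n m)))
    (hH : LiePseudoGroup.IsLiePseudoGroup (X ×ˢ U) H)
    (q : ℕ) (hq : 1 ≤ q)
    (V : Set (LiePseudoGroup.SecJet n m q))
    (hV : V ⊆ LiePseudoGroup.sectionJets (X ×ˢ U) q)
    (hfree : LiePseudoGroup.ActsFreelyOn (X ×ˢ U) H q V) :
    LiePseudoGroup.ActsFreelyOn (X ×ˢ U) H (q + 1)
      {s | s ∈ LiePseudoGroup.sectionJets (X ×ˢ U) (q + 1) ∧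
        LiePseudoGroup.SecJet.proj (Nat.le_succ q) s ∈ V} := by
  rintro s ⟨-, hsV⟩ g ⟨ψ, hψ, z, hzψ, hgψ⟩
    ⟨φ, hφ, u, u', x, hzφ, hu, hu', hgraph, rfl, rfl, hs'⟩
  have hE : IsOpen (X ×ˢ U) := hX.prod hU
  obtain rfl : z = (x, u x) := (congrArg Prod.fst hgψ).symm
  -- The jet `g` has two representatives: `ψ` in `H`, and `φ`, which realizes the action but need
  -- not lie in `H`. They agree only through order `q + 1`.
  have hψφ : ∀ j ≤ q + 1, iteratedFDeriv ℝ j ψ (x, u x) = iteratedFDeriv ℝ j φ (x, u x) :=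
    fun j hj => (congrFun (congrArg Prod.snd hgψ) ⟨j, by omega⟩).symm
  have hx : (φ (x, u x)).1 = x := (congrArg Prod.fst hs').symm
  rw [hx] at hu' hs'
  have huu : ∀ j ≤ q + 1, iteratedFDeriv ℝ j u x = iteratedFDeriv ℝ j u' x :=
    fun j hj => congrFun (congrArg Prod.snd hs') ⟨j, by omega⟩
  have hlow := hfree _ hsV (LiePseudoGroup.mapJet q φ (x, u x))
    ⟨ψ, hψ, (x, u x), hzψ,
      Prod.ext rfl (funext fun j => (hψφ j (by omega)).symm)⟩
    ⟨φ, hφ, u, u', x, hzφ, hu, by rwa [hx], hgraph, rfl, rfl, by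
      rw [hx]
      exact Prod.ext rfl (funext fun j => huu j (by omega))⟩
  have hφk : ∀ j ≤ q, iteratedFDeriv ℝ j φ (x, u x) = iteratedFDeriv ℝ j id (x, u x) :=
    fun j hj => congrFun (congrArg Prod.snd hlow) ⟨j, by omega⟩
  have herr : LiePseudoGroup.graphError φ u u' =ᶠ[𝓝 x] fun _ => 0 := by
    filter_upwards [hgraph] with y hy
    exact sub_eq_zero.2 hy
  -- `φ` maps the graph of `u` into that of `u'`, so the graph error vanishes near `x`, and its
  -- derivative of order `q + 1` is the defect of the leading part.
  have htan : LiePseudoGroup.IsTangential (fderiv ℝ u x)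
      (iteratedFDeriv ℝ (q + 1) φ (x, u x)) := by
    intro v
    rw [← LiePseudoGroup.iteratedFDeriv_graphError
      (LiePseudoGroup.contDiffAt_of_mem_diffeo hφ hzφ) hu.self_of_nhds hu'.self_of_nhds
      (Nat.le_add_left 1 q) (fun j hj => hφk j (by omega)) huu, (herr.iteratedFDeriv ℝ _).eq_of_nhds,
      iteratedFDeriv_const_of_ne (by omega)]
    rfl
  have hS := LiePseudoGroup.iteratedFDeriv_succ_eq_zero_of_isTangential hE hH hq hfree hu hsV hψ hzψ
    (fun j hj => (hψφ j (by omega)).trans (hφk j hj)) (by rwa [hψφ _ le_rfl])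
  rw [hψφ _ le_rfl] at hS
  refine Prod.ext rfl (funext fun j => ?_)
  rcases Nat.lt_succ_iff_lt_or_eq.1 j.2 with hj | hj
  · exact hφk j (Nat.lt_succ_iff.1 hj)
  · obtain rfl : j = Fin.last (q + 1) := Fin.ext hj
    exact hS.trans (iteratedFDeriv_id_of_two_le (by omega) _).symm
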